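/- Let $G=(V,E)$ be a finite connected multigraph with a ribbon structure (a cyclic ordering of the edges at each vertex, called clockwise) that is planar, i.e. the associated closed oriented surface is a sphere. Let $G^*=(V^*,E^*)$ be its dual, whose vertices are the faces of $G$ and whose edges $e^*$ cross the edges $e$ of $G$, with the counter-clockwise cyclic orderings at its vertices. Assume that $G$ and $G^*$ have no loops. For an oriented edge $e$ of $G$, orient $e^*$ so that its head is the face of $G$ lying, at the tail of $e$, between the predecessor of $e$ and $e$, and its tail is the face lying between $e$ and its successor. Notation. $\mathrm{Jac}(G)$ is the group of divisors of degree $0$ on $V$ modulo lending moves (a lending move at $v$ sends one chip from $v$ along every edge at $v$). $\mathcal E(G)=\mathbb ZE/(\mathcal C+\mathcal C^*)$ is the group of integral $1$-chains modulo integral cycles and cuts, and $\partial_G\colon\mathcal E(G)\to \mathrm{Jac}(G)$ is the homomorphism $e\mapsto[e^+-e^-]$ (head minus tail). $\mathcal T(G)$ is the set of spanning trees. For a basepoint $q\in V$, a class $c\in\mathrm{Jac}(G)$ and $T\in\mathcal T(G)$, the rotor-routing map is as follows. Choose a divisor $D$ in the class $c$ that is nonnegative away from $q$, and at every $v\ne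 q$ put the rotor at the first edge of the path in $T$ from $v$ to $q$. Repeatedly fire vertices $v\neq q$ carrying a chip (advance the rotor at $v$ to the next edge in the cyclic order and send a chip from $v$ along that edge) until no vertex other than $q$ carries a chip. Then $c\cdot T$ is the spanning tree formed by the final rotors. The same notions are used for $G^*$. Theorem. 1. The rotor-routing maps of $G$ and $G^*$ are well defined for every basepoint: for all $c$ and $T$ the chips can be so routed, and the final rotors always form one and the same spanning tree, directed towards the basepoint. 2. $e\mapsto e^*$ induces an isomorphism $\mathcal E(G)\cong\mathcal E(G^*)$, and there is an isomorphism $\phi\colon\mathrm{Jac}(G)\to\mathrm{Jac}(G^*)$ that corresponds to it under $\partial_G$ and $\partial_{G^*}$. The assignment $T\mapsto T^*=\{e^*: e\in E\setminus T\}$ defines a bijection $\delta\colon\mathcal T(G)\to\mathcal T(G^*)$. 3. With these maps, $$(c\cdot T)^* = \phi(c)\cdot T^*\qquad\text{for all } c\in\mathrm{Jac}(G),\ T\in\mathcal T(G),$$ where the two rotor-routing maps may be computed with arbitrary basepoints in $V$ and in $V^*$, respectively. -/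

import Mathlib

/-- A ribbon graph (multigraph with a cyclic ordering of the edges at every vertex) with vertex
set `V`, described by its set `D` of oriented edges. `tail d` is the tail of `d`, `rev d` is the
same edge with the opposite orientation, and `next d` is the oriented edge following `d` in the
cyclic order of the oriented edges emanating from the vertex `tail d`. An (unoriented) edge is a
pair `{d, rev d}`. -/
structure RibbonGraph (V : Type*) (D : Type*) where
  tail : D → V
  rev : Equiv.Perm D
  next : Equiv.Perm D
  rev_rev : ∀ d, rev (rev d) = d
  rev_ne : ∀ d, rev d ≠ d
  tail_next : ∀ d, tail (next d) = tail d
  sameCycle_next : ∀ d d', tail d = tail d' → next.SameCycle d d'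

namespace RibbonGraph

variable {V D : Type*} (G : RibbonGraph V D)

/-- The head of an oriented edge. -/
def head (d : D) : V := G.tail (G.rev d)

/-- No edge is a loop. -/
def Loopless : Prop := ∀ d, G.tail d ≠ G.head d

/-- `G.IsWalk u l v`: the list `l` of oriented edges is a walk from `u` to `v`. -/
def IsWalk : V → List D → V → Prop
  | u, [], v => u = v
  | u, d :: l, v => G.tail d = u ∧ IsWalk (G.head d) l v

/-- `G.IsPath u l v`: `l` is a walk from `u` to `v` that does not repeat a vertex. -/
def IsPath (u : V) (l : List D) (v : V) : Prop :=
  G.IsWalk u l v ∧ (u :: l.map G.head).Nodup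

/-- `G.IsCycle u l`: `l` is a directed (simple) cycle of the underlying undirected graph,
starting and ending at `u`. The last condition excludes traversing an edge back and forth. -/
def IsCycle (u : V) (l : List D) : Prop :=
  G.IsWalk u l u ∧ l ≠ [] ∧ (l.map G.head).Nodup ∧ ∀ d ∈ l, G.rev d ∉ l

/-- The graph is nonempty and connected. -/
def Connected : Prop := Nonempty V ∧ ∀ u v, ∃ l, G.IsWalk u l v

section Dual

/-- The permutation `d ↦ rev (next d)` of the oriented edges. Its orbits are the boundary walks
of the faces of `G`: the orbit of `d` consists of the oriented edges `d'` such that the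
face after `d'` (lying between `d'` and `next d'` at the vertex `tail d'`) is the same as the face
after `d`. -/
def faceNext : Equiv.Perm D := G.rev * G.next

/-- The faces of a ribbon graph, i.e. the discs in the complement of `G` in the closed oriented
surface that it determines: one for every orbit of `faceNext`, and one for every isolated vertex
(which, as a component of its own, is embedded in a sphere). -/
abbrev Face : Type _ :=
  Quotient (Equiv.Perm.SameCycle.setoid G.faceNext) ⊕ {v : V // ∀ d, G.tail d ≠ v}

/-- The face between `d` and `next d` at the vertex `tail d`. -/
def faceAfter (d : D) : G.Face :=
  Sum.inl (Quotient.mk (Equiv.Perm.SameCycle.setoid G.faceNext) d)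

/-- The face between the predecessor of `d` and `d` at the vertex `tail d`. -/
def faceBefore (d : D) : G.Face := G.faceAfter (G.next.symm d)

/-- The dual ribbon graph `G*`. Its vertices are the faces of `G`, and its oriented edges are
the oriented edges `d` of `G`, read as their duals `d*`. The tail of `d*` is the face of `G`
after `d` and its head is the face of `G` before `d` (see `head_dual`). If the
cyclic orders of `G` are clockwise, then those of `G*` are counter-clockwise. -/
def dual : RibbonGraph G.Face D where
  tail := G.faceAfter
  rev := G.rev
  next := G.faceNext
  rev_rev := G.rev_rev
  rev_ne := G.rev_ne
  tail_next _ := congrArg Sum.inl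
    (Quotient.sound (s := Equiv.Perm.SameCycle.setoid G.faceNext)
      (Equiv.Perm.sameCycle_apply_left.2 (Equiv.Perm.SameCycle.refl _ _)))
  sameCycle_next _ _ h :=
    Quotient.exact (s := Equiv.Perm.SameCycle.setoid G.faceNext) (Sum.inl.inj h)

theorem head_dual (d : D) : G.dual.head d = G.faceBefore d := by
  have h := G.dual.tail_next (G.next.symm d)
  have h2 : G.dual.next (G.next.symm d) = G.rev d := by
    simp [dual, faceNext]
  rw [h2] at h
  exact h

/-- A connected ribbon graph is planar if the closed oriented surface `S` obtained by gluing a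
disc to every face boundary is a sphere, that is, if `S` has Euler characteristic
`|V| - |E| + |F| = 2`. Here `|D| = 2 |E|`. -/
def IsPlanar : Prop :=
  G.Connected ∧ 2 * Nat.card V + 2 * Nat.card G.Face = Nat.card D + 4

end Dual

section Jacobian

/-- Divisors: the free abelian group on the vertices. -/
abbrev Divisor (_ : RibbonGraph V D) : Type _ := V →₀ ℤ

/-- Divisors of degree zero. -/
noncomputable def Div0 : AddSubgroup G.Divisor := (Finsupp.degree (σ := V) (R := ℤ)).ker

theorem single_sub_single_mem (u v : V) :
    Finsupp.single u 1 - Finsupp.single v 1 ∈ G.Div0 := by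
  simp [Div0, AddMonoidHom.mem_ker]

/-- The boundary `head d - tail d` of an oriented edge. -/
noncomputable def bd (d : D) : G.Div0 :=
  ⟨Finsupp.single (G.head d) 1 - Finsupp.single (G.tail d) 1, G.single_sub_single_mem _ _⟩

variable [Fintype D]

open Classical in
/-- The change of a divisor under a lending move by `v`: along each edge at `v`, a chip is sent
from `v` to the other end. -/
noncomputable def lend (v : V) : G.Div0 := ∑ d with G.tail d = v, G.bd d

/-- The sandpile group: divisors of degree zero modulo lending moves. -/
abbrev Jac : Type _ := G.Div0 ⧸ AddSubgroup.closure (Set.range G.lend)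

/-- The class of a divisor of degree zero in the sandpile group. -/
noncomputable def divClass (A : G.Div0) : G.Jac := QuotientAddGroup.mk A

end Jacobian

section CutsAndCycles

/-- The group `ℤE`: generated by the oriented edges, with the reverse of an oriented
edge being identified with its negative. It is free on the edges, for any choice of orientation. -/
abbrev ZE : Type _ :=
  (D →₀ ℤ) ⧸ AddSubgroup.closure
    (Set.range fun d => (Finsupp.single d 1 + Finsupp.single (G.rev d) 1 : D →₀ ℤ))

/-- An oriented edge as an element of `ℤE`. -/
noncomputable def edge (d : D) : G.ZE := QuotientAddGroup.mk (Finsupp.single d 1)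

/-- The integral cycle space: the span of the directed cycles. -/
noncomputable def cycleSpace : AddSubgroup G.ZE :=
  AddSubgroup.closure {x | ∃ u l, G.IsCycle u l ∧ x = (l.map G.edge).sum}

variable [Fintype D]

open Classical in
/-- The cut of a set `U` of vertices, directed from `U` to its complement. -/
noncomputable def cut (U : Set V) : G.ZE := ∑ d with G.tail d ∈ U ∧ G.head d ∉ U, G.edge d

/-- The integral cut space: the span of all cuts. -/
noncomputable def cutSpace : AddSubgroup G.ZE := AddSubgroup.closure (Set.range G.cut)

/-- The group `ℤE / (cycles + cuts)`. -/
abbrev EdgeGroup : Type _ := G.ZE ⧸ (G.cycleSpace ⊔ G.cutSpace)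

/-- The class of an oriented edge in `ℤE / (cycles + cuts)`. -/
noncomputable def edgeClass (d : D) : G.EdgeGroup := QuotientAddGroup.mk (G.edge d)

end CutsAndCycles

section Boundary

theorem head_rev (d : D) : G.head (G.rev d) = G.tail d := by
  simp [head, G.rev_rev]

theorem bd_rev (d : D) : G.bd (G.rev d) = - G.bd d := by
  apply Subtype.ext
  simp [bd, head, G.rev_rev]

/-- The boundary map `ℤE → Div⁰(G)`, sending an oriented edge to its head minus its tail. -/
noncomputable def boundaryZE : G.ZE →+ G.Div0 :=
  QuotientAddGroup.lift _ (Finsupp.liftAddHom fun d => (zmultiplesHom G.Div0 (G.bd d))) (by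
    rw [AddSubgroup.closure_le]
    rintro _ ⟨d, rfl⟩
    simp [AddMonoidHom.mem_ker, bd_rev])

theorem boundaryZE_edge (d : D) : G.boundaryZE (G.edge d) = G.bd d := by
  simp [boundaryZE, edge]

theorem boundaryZE_walk (u v : V) (l : List D) (h : G.IsWalk u l v) :
    ((G.boundaryZE (l.map G.edge).sum : G.Div0) : G.Divisor)
      = Finsupp.single v 1 - Finsupp.single u 1 := by
  induction l generalizing u with
  | nil =>
    have : u = v := h
    simp [this]
  | cons d l ih =>
    obtain ⟨h1, h2⟩ := h
    simp only [List.map_cons, List.sum_cons, map_add, AddSubgroup.coe_add, ih _ h2,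
      boundaryZE_edge, bd, h1]
    abel

theorem boundaryZE_cycleSpace (x : G.ZE) (hx : x ∈ G.cycleSpace) : G.boundaryZE x = 0 := by
  have : G.cycleSpace ≤ G.boundaryZE.ker := by
    rw [cycleSpace, AddSubgroup.closure_le]
    rintro _ ⟨u, l, h, rfl⟩
    have := G.boundaryZE_walk u u l h.1
    rw [sub_self] at this
    exact Subtype.ext this
  exact this hx

variable [Fintype D]

theorem boundaryZE_cut (U : Set V) :
    G.boundaryZE (G.cut U) ∈ AddSubgroup.closure (Set.range G.lend) := by
  classical
  have h1 : G.boundaryZE (G.cut U) = ∑ d with G.tail d ∈ U ∧ G.head d ∉ U, G.bd d := by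
    simp [cut, boundaryZE_edge]
  have h2 : ∑ d with G.tail d ∈ U ∧ G.head d ∈ U, G.bd d = 0 := by
    apply Finset.sum_involution (fun d _ => G.rev d)
    · intro d _
      simp [bd_rev]
    · intro d _ _
      exact G.rev_ne d
    · intro d hd
      simp only [Finset.mem_filter, Finset.mem_univ, true_and, head_rev] at hd ⊢
      exact ⟨hd.2, hd.1⟩
    · intro d _
      exact G.rev_rev d
  have h3 : ∑ d with G.tail d ∈ U, G.bd d =
      ∑ d with G.tail d ∈ U ∧ G.head d ∉ U, G.bd d := by
    rw [← Finset.sum_filter_add_sum_filter_not _ (fun d => G.head d ∈ U), Finset.filter_filter,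
      Finset.filter_filter, h2, zero_add]
  have h4 : ∑ d with G.tail d ∈ U, G.bd d =
      ∑ v ∈ (Finset.univ.filter fun d => G.tail d ∈ U).image G.tail, G.lend v := by
    rw [Finset.sum_image']
    intro d hd
    simp only [Finset.mem_filter, Finset.mem_univ, true_and] at hd
    rw [lend, Finset.filter_filter]
    apply Finset.sum_congr _ fun _ _ => rfl
    ext e
    simp only [Finset.mem_filter, Finset.mem_univ, true_and]
    exact ⟨fun h => ⟨h ▸ hd, h⟩, fun h => h.2⟩
  rw [h1, ← h3, h4]
  exact AddSubgroup.sum_mem _ fun v _ => AddSubgroup.subset_closure ⟨v, rfl⟩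

/-- The homomorphism `∂ : ℤE / (cycles + cuts) → Jac(G)` induced by the boundary map. -/
noncomputable def boundary : G.EdgeGroup →+ G.Jac :=
  QuotientAddGroup.map _ _ G.boundaryZE (by
    apply sup_le
    · intro x hx
      rw [AddSubgroup.mem_comap, G.boundaryZE_cycleSpace x hx]
      exact zero_mem _
    · rw [cutSpace, AddSubgroup.closure_le]
      rintro _ ⟨U, rfl⟩
      exact G.boundaryZE_cut U)

theorem boundary_edgeClass (d : D) : G.boundary (G.edgeClass d) = G.divClass (G.bd d) := by
  simp [boundary, edgeClass, divClass, boundaryZE_edge]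

end Boundary

section RotorRouting

/-- A spanning tree, given by the set of all orientations of its edges. -/
@[ext]
structure SpanningTree where
  edges : Set D
  rev_mem_iff : ∀ d, G.rev d ∈ edges ↔ d ∈ edges
  exists_path : ∀ u v, ∃ l, G.IsPath u l v ∧ ∀ d ∈ l, d ∈ edges
  acyclic : ∀ u l, G.IsCycle u l → ¬ ∀ d ∈ l, d ∈ edges

/-- A rotor configuration with basepoint `q`: an edge at every vertex `v ≠ q`, oriented so that
its tail is `v`. -/
abbrev RotorConfig (q : V) : Type _ := (v : {v : V // v ≠ q}) → {d : D // G.tail d = v}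

variable {G} in
theorem SpanningTree.exists_first (T : G.SpanningTree) (q : V) (v : {v : V // v ≠ q}) :
    ∃ d l, G.IsPath v (d :: l) q ∧ ∀ e ∈ d :: l, e ∈ T.edges := by
  obtain ⟨l, h1, h2⟩ := T.exists_path v q
  cases l with
  | nil => exact absurd h1.1 v.2
  | cons d l => exact ⟨d, l, h1, h2⟩

variable {G} in
/-- The rotor configuration of a spanning tree `T` rooted at `q`: the rotor at `v ≠ q` is the
first edge of the path in `T` from `v` to `q`. -/
noncomputable def SpanningTree.rotor (T : G.SpanningTree) (q : V) : G.RotorConfig q := fun v =>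
  ⟨(T.exists_first q v).choose, (T.exists_first q v).choose_spec.choose_spec.1.1.1⟩

/-- The rotor at `v` advanced to the next edge in the cyclic order at `v`. -/
def advance {q : V} (ρ : G.RotorConfig q) (v : {v : V // v ≠ q}) : {d : D // G.tail d = v} :=
  ⟨G.next (ρ v), (G.tail_next _).trans (ρ v).2⟩

open Classical in
/-- One firing: a vertex `v ≠ q` carrying a chip advances its rotor to the next edge and then
sends a chip to the other end of the new rotor. -/
inductive Fires (q : V) : G.Divisor × G.RotorConfig q → G.Divisor × G.RotorConfig q → Prop
  | fire (A : G.Divisor) (ρ : G.RotorConfig q) (v : {v : V // v ≠ q}) (hv : 0 < A v) :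
      Fires q (A, ρ)
        (A - Finsupp.single v.1 1 + Finsupp.single (G.head (G.advance ρ v).1) 1,
          Function.update ρ v (G.advance ρ v))

variable [Fintype D]

/-- Rotor-routing of the class `c` with basepoint `q` can transform the rotor configuration `ρ`
into `ρ'`: some representative of `c` that is nonnegative away from `q` can, by
firings, have all its chips routed into `q`, with `ρ'` the rotor configuration at the end. -/
def RoutesTo (q : V) (c : G.Jac) (ρ ρ' : G.RotorConfig q) : Prop :=
  ∃ A : G.Div0, G.divClass A = c ∧ (∀ v, v ≠ q → 0 ≤ (A : G.Divisor) v) ∧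
    ∃ A' : G.Divisor, Relation.ReflTransGen (G.Fires q) (A, ρ) (A', ρ') ∧ ∀ v, v ≠ q → A' v = 0

open Classical in
/-- The rotor-routing map with basepoint `q`: `G.rotorAction q c T` is the spanning
tree into which rotor-routing of `c` transforms `T` (with value `T` if there were no such tree). -/
noncomputable def rotorAction (q : V) (c : G.Jac) (T : G.SpanningTree) : G.SpanningTree :=
  if h : ∃ T' : G.SpanningTree, G.RoutesTo q c (T.rotor q) (T'.rotor q) then h.choose else T

/-- Rotor-routing with basepoint `q` is well defined on spanning trees: for every class `c` and
every spanning tree `T` the chips can be routed into `q`, and however this is done, the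
rotor configuration at the end is that of the spanning tree `G.rotorAction q c T`. -/
def RotorActionWellDefined (q : V) : Prop :=
  ∀ (c : G.Jac) (T : G.SpanningTree) (ρ' : G.RotorConfig q),
    G.RoutesTo q c (T.rotor q) ρ' ↔ ρ' = (G.rotorAction q c T).rotor q

end RotorRouting

end RibbonGraph

namespace RibbonGraph

variable {V D : Type*} {G : RibbonGraph V D}

/-! Rotor-routing is controlled by an invariant with values in `Jac`. The boundaries of the darts at
a vertex add up to a lending move, which is zero in `Jac`, so there is a function `r` on darts that
grows by the class of `bd d` whenever a rotor advances to `d` (`IsRotorPotential`). A firing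
preserves the sum of `r` over the rotors minus the class of the chips. Hence routing `c` lowers the
rotor sum by exactly `c`, whatever the representative and the order of firing
(`IsRotorPotential.routesTo`). For a fixed basepoint a tree is determined by its rotor sum
(`IsRotorPotential.rotor_unique`, a flow argument). Well-definedness follows, because routing
terminates (`exists_fires_terminal`) and takes trees to trees (`IsTreeRotor.fires`).

Compatibility with duality rests on making `r` symmetric under reversal
(`IsDual.exists_symmetric_potential`). The defect `r d - r (rev d)` sums to zero around every face.
On the sphere face boundaries generate all cycles (`IsDual.ker_boundaryZE_le`), so the defect is a
coboundary and is absorbed by an additive constant at each vertex. The rotor sum is then a sum over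
the unoriented edges of the tree and no longer sees the basepoint. Moreover `-φ ∘ r` is a rotor
potential of the dual, and its sum over the complementary tree is `φ` of the sum over the tree, up
to a constant independent of the tree. So both sides of the compatibility have the same dual
potential and coincide.

The isomorphism `φ` comes from edge duality, which exchanges face boundaries with vertex cuts, and
from the bijectivity of `boundary` on a connected graph (`boundary_bijective`). -/

theorem tail_rev (d : D) : G.tail (G.rev d) = G.head d := rfl

/-! ### Walks, paths and cycles. -/

section Walks

theorem IsWalk.append {u v w : V} {l l' : List D} (h : G.IsWalk u l v) (h' : G.IsWalk v l' w) :
    G.IsWalk u (l ++ l') w := by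
  induction l generalizing u with
  | nil =>
    obtain rfl : u = v := h
    exact h'
  | cons d l ih => exact ⟨h.1, ih h.2⟩

theorem IsWalk.reverse {u v : V} {l : List D} (h : G.IsWalk u l v) :
    G.IsWalk v (l.reverse.map G.rev) u := by
  induction l generalizing u with
  | nil => exact Eq.symm h
  | cons d l ih =>
    rw [List.reverse_cons, List.map_append]
    exact (ih h.2).append ⟨rfl, (G.head_rev d).trans h.1⟩

theorem isPath_cons {u v : V} {d : D} {l : List D} :
    G.IsPath u (d :: l) v ↔
      G.tail d = u ∧ G.IsPath (G.head d) l v ∧ u ∉ G.head d :: l.map G.head := by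
  simp only [IsPath, IsWalk, List.map_cons, List.nodup_cons (a := u)]
  tauto

theorem IsPath.exists_suffix {u v a : V} {l : List D} (h : G.IsPath a l v)
    (hu : u ∈ a :: l.map G.head) : ∃ l', G.IsPath u l' v ∧ l' ⊆ l := by
  induction l generalizing a with
  | nil =>
    obtain rfl : u = a := by simpa using hu
    exact ⟨[], h, by simp⟩
  | cons d l ih =>
    rcases List.mem_cons.1 hu with rfl | hu
    · exact ⟨_, h, fun _ h => h⟩
    · obtain ⟨l', h1, h2⟩ := ih (isPath_cons.1 h).2.1 hu
      exact ⟨l', h1, fun e he => List.mem_cons_of_mem _ (h2 he)⟩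

theorem IsWalk.exists_isPath {u v : V} {l : List D} (h : G.IsWalk u l v) :
    ∃ l', G.IsPath u l' v ∧ l' ⊆ l := by
  induction l generalizing u with
  | nil => exact ⟨[], ⟨h, by simp⟩, by simp⟩
  | cons d l ih =>
    obtain ⟨l', h1, h2⟩ := ih h.2
    by_cases hu : u ∈ G.head d :: l'.map G.head
    · obtain ⟨l'', h3, h4⟩ := h1.exists_suffix hu
      exact ⟨l'', h3, fun e he => List.mem_cons_of_mem _ (h2 (h4 he))⟩
    · refine ⟨d :: l', isPath_cons.2 ⟨h.1, h1, hu⟩, ?_⟩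
      exact List.cons_subset_cons _ h2

theorem IsPath.rev_notMem {u v : V} {l : List D} (h : G.IsPath u l v) :
    ∀ d ∈ l, G.rev d ∉ l := by
  induction l generalizing u with
  | nil => simp
  | cons d l ih =>
    obtain ⟨h1, h2, h3⟩ := isPath_cons.1 h
    have key : G.rev d ∉ l := fun hd =>
      h3 (List.mem_cons_of_mem _ (List.mem_map.2 ⟨_, hd, (G.head_rev d).trans h1⟩))
    intro e he he'
    rcases List.mem_cons.1 he with rfl | he
    · rcases List.mem_cons.1 he' with h | h
      · exact G.rev_ne _ h
      · exact key h
    · rcases List.mem_cons.1 he' with h | h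
      · exact key (by rwa [← h, G.rev_rev])
      · exact ih h2 e he h

/-- Closing up a path by an edge outside it gives a cycle. -/
theorem IsPath.isCycle {d : D} {l : List D} (h : G.IsPath (G.head d) l (G.tail d))
    (hd : d ∉ l) (hd' : G.rev d ∉ l) : G.IsCycle (G.tail d) (d :: l) := by
  refine ⟨⟨rfl, h.1⟩, by simp, h.2, ?_⟩
  intro e he he'
  rcases List.mem_cons.1 he with rfl | he
  · rcases List.mem_cons.1 he' with h | h
    · exact G.rev_ne _ h
    · exact hd' h
  · rcases List.mem_cons.1 he' with h' | h'
    · exact hd' (by rwa [← h', G.rev_rev])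
    · exact h.rev_notMem e he h'

/-- A set of vertices that is closed under adjacency contains the end of every walk that starts
in it. -/
theorem IsWalk.mem_of_closed {u v : V} {l : List D} (h : G.IsWalk u l v) {U : Set V}
    (hU : ∀ d ∈ l, G.tail d ∈ U → G.head d ∈ U) (hu : u ∈ U) : v ∈ U := by
  induction l generalizing u with
  | nil =>
    obtain rfl : u = v := h
    exact hu
  | cons d l ih =>
    exact ih h.2 (fun e he => hU e (List.mem_cons_of_mem _ he))
      (hU d List.mem_cons_self (h.1 ▸ hu))

end Walks

/-! ### Spanning trees as rotor configurations with a decreasing height. -/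

section TreeRotors

variable {q : V}

/-- A rotor configuration directed towards the basepoint: along the rotors, some height function
decreases. -/
def IsTreeRotor (ρ : G.RotorConfig q) : Prop :=
  ∃ h : V → ℕ, ∀ v, h (G.head (ρ v).1) < h v.1

/-- All orientations of the edges on which the rotors lie. -/
def rotorEdges (ρ : G.RotorConfig q) : Set D := {d | ∃ v, d = (ρ v).1 ∨ d = G.rev (ρ v).1}

theorem mem_rotorEdges (ρ : G.RotorConfig q) (v) : (ρ v).1 ∈ rotorEdges ρ := ⟨v, Or.inl rfl⟩

theorem rev_mem_rotorEdges {ρ : G.RotorConfig q} {d : D} :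
    G.rev d ∈ rotorEdges ρ ↔ d ∈ rotorEdges ρ := by
  have key : ∀ {d}, d ∈ rotorEdges ρ → G.rev d ∈ rotorEdges ρ := by
    rintro d ⟨v, rfl | rfl⟩
    · exact ⟨v, Or.inr rfl⟩
    · exact ⟨v, Or.inl (G.rev_rev _)⟩
  exact ⟨fun h => G.rev_rev d ▸ key h, key⟩

/-- Each rotor starts a shortest walk to `q` inside `E`; the height is the distance to `q` in `E`.
-/
theorem exists_treeRotor {E : Set D} (hE : ∀ v, ∃ l, G.IsWalk v l q ∧ ∀ d ∈ l, d ∈ E) :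
    ∃ ρ : G.RotorConfig q, IsTreeRotor ρ ∧ ∀ v, (ρ v).1 ∈ E := by
  classical
  have hE' : ∀ v, ∃ n, ∃ l, l.length = n ∧ G.IsWalk v l q ∧ ∀ d ∈ l, d ∈ E := fun v =>
    let ⟨l, hl⟩ := hE v
    ⟨_, l, rfl, hl⟩
  have key : ∀ v : {v : V // v ≠ q}, ∃ d : {d : D // G.tail d = v}, d.1 ∈ E ∧
      Nat.find (hE' (G.head d.1)) < Nat.find (hE' v) := by
    intro v
    obtain ⟨l, h1, h2, h3⟩ := Nat.find_spec (hE' v)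
    cases l with
    | nil => exact absurd h2 v.2
    | cons d l =>
      refine ⟨⟨d, h2.1⟩, h3 d List.mem_cons_self, ?_⟩
      rw [← h1, List.length_cons, Nat.lt_succ_iff]
      exact Nat.find_min' _ ⟨l, rfl, h2.2, fun e he => h3 e (List.mem_cons_of_mem _ he)⟩
  choose ρ h1 h2 using key
  exact ⟨ρ, ⟨fun v => Nat.find (hE' v), h2⟩, h1⟩

theorem IsTreeRotor.exists_walk {ρ : G.RotorConfig q} (hρ : IsTreeRotor ρ) (v : V) :
    ∃ l, G.IsWalk v l q ∧ ∀ d ∈ l, d ∈ rotorEdges ρ := by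
  obtain ⟨h, hh⟩ := hρ
  induction hn : h v using Nat.strong_induction_on generalizing v with
  | _ n ih =>
    by_cases hv : v = q
    · exact ⟨[], hv, by simp⟩
    · obtain ⟨l, h1, h2⟩ := ih _ (hn ▸ hh ⟨v, hv⟩) _ rfl
      refine ⟨(ρ ⟨v, hv⟩).1 :: l, ⟨(ρ ⟨v, hv⟩).2, h1⟩, ?_⟩
      simpa using ⟨mem_rotorEdges _ _, h2⟩

theorem IsTreeRotor.exists_path {ρ : G.RotorConfig q} (hρ : IsTreeRotor ρ) (u v : V) :
    ∃ l, G.IsPath u l v ∧ ∀ d ∈ l, d ∈ rotorEdges ρ := by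
  obtain ⟨l, h1, h2⟩ := hρ.exists_walk u
  obtain ⟨l', h1', h2'⟩ := hρ.exists_walk v
  obtain ⟨p, h3, h4⟩ := (h1.append h1'.reverse).exists_isPath
  refine ⟨p, h3, fun d hd => ?_⟩
  rcases List.mem_append.1 (h4 hd) with h | h
  · exact h2 d h
  · obtain ⟨e, he, rfl⟩ := List.mem_map.1 h
    exact rev_mem_rotorEdges.2 (h2' e (List.mem_reverse.1 he))

open Classical in
theorem bd_apply (d : D) (v : V) :
    (G.bd d : G.Divisor) v = (if G.head d = v then 1 else 0) - (if G.tail d = v then 1 else 0) := by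
  simp [bd, Finsupp.single_apply]

/-- The edges of a tree support no nonzero cycle with coefficients in `{-1, 0, 1}`. -/
theorem IsTreeRotor.eq_empty_of_sum_bd {ρ : G.RotorConfig q} (hρ : IsTreeRotor ρ) {K : Finset D}
    (hK : ∀ d ∈ K, d ∈ rotorEdges ρ) (hK' : ∀ d ∈ K, G.rev d ∉ K) (h0 : ∑ d ∈ K, G.bd d = 0) :
    K = ∅ := by
  classical
  obtain ⟨h, hh⟩ := hρ
  by_contra hne
  have : ∀ d : D, ∃ n : ℕ, d ∈ K → ∃ v, (d = (ρ v).1 ∨ d = G.rev (ρ v).1) ∧ h v = n := by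
    intro d
    by_cases hd : d ∈ K
    · obtain ⟨v, hv⟩ := hK d hd
      exact ⟨_, fun _ => ⟨v, hv, rfl⟩⟩
    · exact ⟨0, fun h => absurd h hd⟩
  choose n hn using this
  -- At the highest vertex whose rotor underlies a dart of `K`, no other dart of `K` has an end, so
  -- the boundary there is `±1`.
  obtain ⟨d, hd, hmax⟩ := K.exists_max_image n (Finset.nonempty_iff_ne_empty.2 hne)
  obtain ⟨v, hv, hvn⟩ := hn d hd
  have h1 := congrArg (fun A : G.Div0 => (A : G.Divisor) v) h0
  simp only [AddSubgroup.val_finsetSum, Finsupp.finsetSum_apply] at h1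
  have hloop : G.head (ρ v).1 ≠ v := fun he => by
    have := hh v
    rw [he] at this
    exact lt_irrefl _ this
  rw [Finset.sum_eq_single_of_mem d hd] at h1
  · rcases hv with rfl | rfl
    · rw [bd_apply, if_neg hloop, if_pos (ρ v).2] at h1
      simp at h1
    · rw [bd_apply, head_rev, tail_rev, if_neg hloop, if_pos (ρ v).2] at h1
      simp at h1
  · intro e he hed
    obtain ⟨u, hu, hun⟩ := hn e he
    have huv : u ≠ v := by
      rintro rfl
      rcases hv with rfl | rfl <;> rcases hu with rfl | rfl
      · exact hed rfl
      · exact hK' _ hd he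
      · exact hK' _ he hd
      · exact hed rfl
    have h3 : G.head (ρ u).1 ≠ v := fun h3 => by
      have h4 := hh u
      have h5 := hmax e he
      rw [h3] at h4
      omega
    have h4 : G.tail (ρ u).1 ≠ v := fun h4 => huv (Subtype.ext ((ρ u).2.symm.trans h4))
    rcases hu with rfl | rfl
    · rw [bd_apply, if_neg h3, if_neg h4, sub_self]
    · rw [bd_apply, head_rev, tail_rev, if_neg h3, if_neg h4, sub_self]

/-- The rotors of a tree are linearly independent modulo cycles. -/
theorem IsTreeRotor.eq_zero_of_sum_bd [Fintype {v : V // v ≠ q}] {ρ : G.RotorConfig q}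
    (hρ : IsTreeRotor ρ) {c : {v : V // v ≠ q} → ℤ} (h0 : ∑ v, c v • G.bd (ρ v).1 = 0) :
    c = 0 := by
  classical
  obtain ⟨h, hh⟩ := hρ
  by_contra hne
  obtain ⟨w, hw⟩ := Function.ne_iff.1 hne
  obtain ⟨v, hv, hmax⟩ := (Finset.univ.filter fun v => c v ≠ 0).exists_max_image (fun v => h v.1)
    ⟨w, by simpa using hw⟩
  have hv' : c v ≠ 0 := by simpa using hv
  have h1 := congrArg (fun A : G.Div0 => (A : G.Divisor) v) h0
  simp only [AddSubgroup.val_finsetSum, Finsupp.finsetSum_apply] at h1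
  rw [Finset.sum_eq_single v] at h1
  · have hloop : G.head (ρ v).1 ≠ v := fun he => by
      have := hh v
      rw [he] at this
      exact lt_irrefl _ this
    rw [AddSubgroup.coe_zsmul, Finsupp.smul_apply, bd_apply, if_neg hloop, if_pos (ρ v).2] at h1
    simp [hv'] at h1
  · intro u _ huv
    by_cases hu : c u = 0
    · simp [hu]
    have h3 : G.head (ρ u).1 ≠ v := fun h3 => by
      have h4 := hh u
      have h5 := hmax u (by simpa using hu)
      rw [h3] at h4
      omega
    have h4 : G.tail (ρ u).1 ≠ v := fun h4 => huv (Subtype.ext ((ρ u).2.symm.trans h4))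
    rw [AddSubgroup.coe_zsmul, Finsupp.smul_apply, bd_apply, if_neg h3, if_neg h4]
    simp
  · simp

theorem IsCycle.sum_bd {u : V} {l : List D} (h : G.IsCycle u l) : (l.map G.bd).sum = 0 := by
  have h1 := G.boundaryZE_walk u u l h.1
  rw [sub_self] at h1
  have h2 : G.boundaryZE (l.map G.edge).sum = 0 := Subtype.ext h1
  simpa [map_list_sum, Function.comp_def, boundaryZE_edge] using h2

/-- The spanning tree formed by the rotors. -/
def treeOfRotor (ρ : G.RotorConfig q) (hρ : IsTreeRotor ρ) : G.SpanningTree where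
  edges := rotorEdges ρ
  rev_mem_iff _ := rev_mem_rotorEdges
  exists_path := hρ.exists_path
  acyclic u l h hl := by
    classical
    have hnd : l.Nodup := h.2.2.1.of_map _
    have h1 := hρ.eq_empty_of_sum_bd (K := l.toFinset) (by simpa using hl)
      (by simpa using h.2.2.2) (by rw [List.sum_toFinset _ hnd, h.sum_bd])
    exact h.2.1 (by simpa using h1)

/-- A path in the tree that once runs against a rotor does so for ever: using the rotor at the
vertex just reached would step straight back. Every vertex it reaches therefore carries a rotor. -/
theorem ne_of_isPath_rev {ρ : G.RotorConfig q} {l : List D} {v w : V} {u : {v : V // v ≠ q}}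
    (h : G.IsPath v (G.rev (ρ u).1 :: l) w) (hl : ∀ d ∈ l, d ∈ rotorEdges ρ) : w ≠ q := by
  induction l generalizing u v with
  | nil =>
    have h1 : G.head (G.rev (ρ u).1) = w := h.1.2
    rw [head_rev, (ρ u).2] at h1
    exact h1 ▸ u.2
  | cons e l ih =>
    obtain ⟨h1, h2, h3⟩ := isPath_cons.1 h
    have h4 := (isPath_cons.1 h2).1
    rw [head_rev, (ρ u).2] at h4
    obtain ⟨x, rfl | rfl⟩ := hl _ List.mem_cons_self
    · obtain rfl : x = u := Subtype.ext ((ρ x).2.symm.trans h4)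
      exact absurd (by simp [← h1, tail_rev]) h3
    · exact ih h2 fun d hd => hl d (List.mem_cons_of_mem _ hd)

theorem eq_rotor_of_isPath {ρ : G.RotorConfig q} {l : List D} {v : {v : V // v ≠ q}} {d : D}
    (h : G.IsPath v (d :: l) q) (hl : ∀ e ∈ d :: l, e ∈ rotorEdges ρ) : d = (ρ v).1 := by
  obtain ⟨x, rfl | rfl⟩ := hl d List.mem_cons_self
  · obtain rfl : x = v := Subtype.ext ((ρ x).2.symm.trans (isPath_cons.1 h).1)
    rfl
  · exact absurd rfl (ne_of_isPath_rev h fun d hd => hl d (List.mem_cons_of_mem _ hd))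

theorem SpanningTree.rotor_eq {T : G.SpanningTree} {ρ : G.RotorConfig q}
    (h : T.edges = rotorEdges ρ) : T.rotor q = ρ := by
  funext v
  apply Subtype.ext
  have := (T.exists_first q v).choose_spec.choose_spec
  exact eq_rotor_of_isPath this.1 (h ▸ this.2)

theorem rotor_treeOfRotor (ρ : G.RotorConfig q) (hρ : IsTreeRotor ρ) :
    (treeOfRotor ρ hρ).rotor q = ρ := SpanningTree.rotor_eq rfl

/-- Shortest-path rotors inside `T` already form a spanning tree, so a further edge of `T` would
close a cycle in `T`. -/
theorem SpanningTree.exists_rotorEdges (T : G.SpanningTree) (q : V) :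
    ∃ ρ : G.RotorConfig q, IsTreeRotor ρ ∧ T.edges = rotorEdges ρ := by
  obtain ⟨ρ, h1, h2⟩ := exists_treeRotor (G := G) (q := q) (E := T.edges) fun v =>
    let ⟨l, h⟩ := T.exists_path v q
    ⟨l, h.1.1, h.2⟩
  have h3 : rotorEdges ρ ⊆ T.edges := by
    rintro d ⟨v, rfl | rfl⟩
    · exact h2 v
    · exact (T.rev_mem_iff _).2 (h2 v)
  refine ⟨ρ, h1, (Set.Subset.antisymm h3 fun d hd => ?_).symm⟩
  by_contra hd'
  obtain ⟨l, hl, hl'⟩ := h1.exists_path (G.head d) (G.tail d)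
  refine T.acyclic _ _ (hl.isCycle (fun h => hd' (hl' _ h))
    fun h => hd' (rev_mem_rotorEdges.1 (hl' _ h))) fun e he => ?_
  rcases List.mem_cons.1 he with rfl | he
  · exact hd
  · exact h3 (hl' _ he)

theorem SpanningTree.isTreeRotor (T : G.SpanningTree) (q : V) : IsTreeRotor (T.rotor q) := by
  obtain ⟨ρ, h1, h2⟩ := T.exists_rotorEdges q
  rwa [rotor_eq h2]

theorem SpanningTree.edges_eq (T : G.SpanningTree) (q : V) :
    T.edges = rotorEdges (T.rotor q) := by
  obtain ⟨ρ, h1, h2⟩ := T.exists_rotorEdges q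
  rwa [rotor_eq h2]

theorem SpanningTree.rotor_injective {T T' : G.SpanningTree} (h : T.rotor q = T'.rotor q) :
    T = T' := by
  ext1
  rw [T.edges_eq q, T'.edges_eq q, h]

theorem IsTreeRotor.rev_ne {ρ : G.RotorConfig q} (hρ : IsTreeRotor ρ) (u v) :
    G.rev (ρ u).1 ≠ (ρ v).1 := by
  obtain ⟨h, hh⟩ := hρ
  intro he
  have h1 : G.head (ρ u).1 = v := by rw [← tail_rev, he, (ρ v).2]
  have h2 : G.head (ρ v).1 = u := by rw [← he, head_rev, (ρ u).2]
  have h3 := hh u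
  have h4 := hh v
  rw [h1] at h3
  rw [h2] at h4
  omega

theorem rotorConfig_injective (ρ : G.RotorConfig q) : Function.Injective fun v => (ρ v).1 := by
  intro u v h
  apply Subtype.ext
  rw [← (ρ u).2, ← (ρ v).2]
  exact congrArg G.tail h

theorem IsTreeRotor.card [Finite V] {ρ : G.RotorConfig q} (hρ : IsTreeRotor ρ) :
    (rotorEdges ρ).ncard + 2 = 2 * Nat.card V := by
  classical
  have := Fintype.ofFinite V
  let f : {v : V // v ≠ q} ⊕ {v : V // v ≠ q} → D :=
    Sum.elim (fun v => (ρ v).1) fun v => G.rev (ρ v).1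
  have hf : Function.Injective f := by
    refine (rotorConfig_injective ρ).sumElim (G.rev.injective.comp (rotorConfig_injective ρ)) ?_
    exact fun u v h => hρ.rev_ne v u h.symm
  have hr : rotorEdges ρ = Set.range f := by
    ext d
    simp only [rotorEdges, Set.mem_ofPred_eq, Set.mem_range, Sum.exists, f, Sum.elim_inl,
      Sum.elim_inr, exists_or, eq_comm]
  have h1 : Nat.card {v : V // v ≠ q} + 1 = Nat.card V := by
    rw [Nat.card_eq_fintype_card, Nat.card_eq_fintype_card, Fintype.card_subtype_compl,
      Fintype.card_subtype_eq]
    exact Nat.sub_add_cancel (Fintype.card_pos_iff.2 ⟨q⟩)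
  rw [hr, ← Nat.card_coe_set_eq, Nat.card_range_of_injective hf, Nat.card_sum]
  omega

end TreeRotors

end RibbonGraph

namespace RibbonGraph

variable {V D : Type*} {G : RibbonGraph V D}

theorem tail_eq_of_sameCycle [Finite D] {d d' : D} (h : G.next.SameCycle d d') :
    G.tail d' = G.tail d := by
  obtain ⟨k, -, rfl⟩ := h.exists_pow_eq'
  clear h
  induction k with
  | zero => rfl
  | succ k ih => rw [pow_succ', Equiv.Perm.mul_apply, G.tail_next, ih]

/-- Following the rotors lowers the height, so from any vertex they eventually reach `q`. -/
theorem IsTreeRotor.eq_empty_of_closed {q : V} {ρ : G.RotorConfig q} (hρ : IsTreeRotor ρ)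
    {C : Set V} (hq : q ∉ C) (hC : ∀ v : {v : V // v ≠ q}, v.1 ∈ C → G.head (ρ v).1 ∈ C) :
    C = ∅ := by
  obtain ⟨h, hh⟩ := hρ
  have key : ∀ n v, h v = n → v ∉ C := by
    intro n
    induction n using Nat.strong_induction_on with
    | _ n ih =>
      rintro v rfl hv
      have hvq : v ≠ q := fun e => hq (e ▸ hv)
      exact ih _ (hh ⟨v, hvq⟩) _ rfl (hC ⟨v, hvq⟩ hv)
  exact Set.eq_empty_of_forall_notMem fun v => key _ v rfl

/-! ### Conserved integer flows on darts. -/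

section Flow

variable [Fintype D]

theorem sum_bd : ∑ d, G.bd d = 0 := by
  refine Finset.sum_involution (fun d _ => G.rev d) ?_ ?_ ?_ ?_
  · intro d _
    simp [bd_rev]
  · intro d _ _
    exact G.rev_ne d
  · simp
  · intro d _
    exact G.rev_rev d

theorem sum_zsmul_lend [Fintype V] (m : V → ℤ) :
    ∑ v, m v • G.lend v = ∑ d, m (G.tail d) • G.bd d := by
  classical
  rw [← Finset.sum_fiberwise_of_maps_to (s := Finset.univ) (t := Finset.univ) (g := G.tail)
    (fun _ _ => Finset.mem_univ _)]
  refine Finset.sum_congr rfl fun v _ => ?_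
  rw [lend, Finset.smul_sum]
  refine Finset.sum_congr (by ext; simp) fun d hd => ?_
  rw [(Finset.mem_filter.1 hd).2]

/-- A conserved flow that is nonnegative on all darts starting in `P` and nonpositive on all other
darts vanishes on the darts leading out of `P`. -/
theorem flow_eq_zero {x : D → ℤ} (hx : ∑ d, x d • G.bd d = 0) {P : Set V}
    (h1 : ∀ d, G.tail d ∈ P → 0 ≤ x d) (h2 : ∀ d, G.tail d ∉ P → x d ≤ 0) {d : D}
    (hd : G.tail d ∈ P) (hd' : G.head d ∉ P) : x d = 0 := by
  classical
  let π : G.Divisor →+ ℤ :=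
    Finsupp.liftAddHom fun v => if v ∈ P then AddMonoidHom.id ℤ else 0
  have hπ : ∀ v, π (Finsupp.single v 1) = if v ∈ P then 1 else 0 := by
    intro v
    simp only [π, Finsupp.liftAddHom_apply_single]
    split_ifs <;> simp
  -- Evaluating the boundary on the indicator of `P` gives a sum in which only darts crossing the
  -- border of `P` count. Both sign conditions make every term nonpositive, so each one vanishes.
  have h3 := congrArg (fun A : G.Div0 => π A) hx
  simp only [AddSubgroup.val_finsetSum, AddSubgroup.coe_zsmul, map_sum, map_zsmul, bd, map_sub,
    hπ, ZeroMemClass.coe_zero, map_zero] at h3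
  rw [Finset.sum_eq_zero_iff_of_nonpos] at h3
  · simpa [hd, hd'] using h3 d (Finset.mem_univ _)
  · intro e _
    have := h1 e
    have := h2 e
    by_cases he : G.tail e ∈ P <;> by_cases he' : G.head e ∈ P <;> simp_all

end Flow

/-! ### Termination of routing. -/

section Termination

variable {q : V}

open Classical in
-- `n d` counts the chips sent along `d`. As rotors turn cyclically, the counts around a vertex can
-- change only just after the initial rotor and just after the present one.
theorem fires_flow {s t : G.Divisor × G.RotorConfig q} (h : Relation.TransGen (G.Fires q) s t)
    [Fintype D] :
    ∃ n : D → ℕ, t.1 = s.1 + ∑ d, (n d : ℤ) • (G.bd d : G.Divisor) ∧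
      (∀ d, G.tail d = q → n d = 0) ∧ (∃ d, n d ≠ 0) ∧
      ∀ (v : {v : V // v ≠ q}) (d : D), G.tail d = v → (n (G.next d) : ℤ) =
        n d + (if d = (s.2 v).1 then 1 else 0) - (if d = (t.2 v).1 then 1 else 0) := by
  have step : ∀ {t t' : G.Divisor × G.RotorConfig q}, G.Fires q t t' → ∀ n : D → ℕ,
      t.1 = s.1 + ∑ d, (n d : ℤ) • (G.bd d : G.Divisor) → (∀ d, G.tail d = q → n d = 0) →
      (∀ (v : {v : V // v ≠ q}) (d : D), G.tail d = v → (n (G.next d) : ℤ) =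
        n d + (if d = (s.2 v).1 then 1 else 0) - (if d = (t.2 v).1 then 1 else 0)) →
      ∃ n : D → ℕ, t'.1 = s.1 + ∑ d, (n d : ℤ) • (G.bd d : G.Divisor) ∧
      (∀ d, G.tail d = q → n d = 0) ∧ (∃ d, n d ≠ 0) ∧
      ∀ (v : {v : V // v ≠ q}) (d : D), G.tail d = v → (n (G.next d) : ℤ) =
        n d + (if d = (s.2 v).1 then 1 else 0) - (if d = (t'.2 v).1 then 1 else 0) := by
    rintro _ _ ⟨A, ρ, v, hv⟩ n h1 h2 h3
    have hv' : G.tail (G.next (ρ v).1) = v := (G.tail_next _).trans (ρ v).2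
    refine ⟨n + Pi.single (G.next (ρ v).1) 1, ?_, ?_, ⟨G.next (ρ v).1, by simp⟩, ?_⟩
    · simp only [Pi.add_apply, Nat.cast_add, add_smul, Finset.sum_add_distrib]
      rw [← add_assoc, ← h1, Finset.sum_eq_single (G.next (ρ v).1)]
      · simp only [Pi.single_eq_same, Nat.cast_one, one_smul, bd, hv', advance]
        abel
      · intro d _ hd
        simp [hd]
      · simp
    · intro d hd
      have : d ≠ G.next (ρ v).1 := by
        rintro rfl
        exact v.2 (hv'.symm.trans hd)
      simp [h2 d hd, this]
    · intro u d hd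
      have h4 := h3 u d hd
      simp only at h4
      simp only [Pi.add_apply, Nat.cast_add]
      rw [h4]
      by_cases huv : u = v
      · subst huv
        simp only [Function.update_self, advance, Pi.single_apply, EmbeddingLike.apply_eq_iff_eq]
        push_cast
        ring
      · simp only [Function.update_of_ne huv]
        have h5 : d ≠ G.next (ρ v).1 := by
          rintro rfl
          exact huv (Subtype.ext (hd.symm.trans hv'))
        have h6 : d ≠ (ρ v).1 := by
          rintro rfl
          exact huv (Subtype.ext (hd.symm.trans (ρ v).2))
        simp [h5, h6]
  induction h with
  | single h => exact step h 0 (by simp) (by simp) (by simp)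
  | tail _ h ih =>
    obtain ⟨n, h1, h2, -, h3⟩ := ih
    exact step h n h1 h2 h3

/-- If a state recurred, the counts of `fires_flow` would be constant around each vertex and form a
conserved flow. By `flow_eq_zero` no chip leaves the set of vertices that fired, so by connectedness
this set contains `q`, which never fires. -/
theorem not_fires_cycle [Finite D] (hG : G.Connected) (s : G.Divisor × G.RotorConfig q) :
    ¬ Relation.TransGen (G.Fires q) s s := by
  classical
  have := Fintype.ofFinite D
  intro h
  obtain ⟨n, h1, h2, ⟨e, he⟩, h3⟩ := fires_flow h
  have h4 : ∀ d, n (G.next d) = n d := by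
    intro d
    by_cases hd : G.tail d = q
    · rw [h2 d hd, h2 _ ((G.tail_next d).trans hd)]
    · have := h3 ⟨G.tail d, hd⟩ d rfl
      rw [add_sub_cancel_right] at this
      exact_mod_cast this
  have h5 : ∀ d d', G.tail d = G.tail d' → n d' = n d := by
    intro d d' hd
    obtain ⟨k, -, rfl⟩ := (G.sameCycle_next d d' hd).exists_pow_eq'
    clear hd
    induction k with
    | zero => rfl
    | succ k ih => rw [pow_succ', Equiv.Perm.mul_apply, h4, ih]
  have h6 : ∑ d, (n d : ℤ) • G.bd d = 0 := Subtype.ext (by simpa using h1)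
  obtain ⟨l, hl⟩ := hG.2 (G.tail e) q
  have h7 : q ∈ {v | ∃ d, G.tail d = v ∧ n d ≠ 0} := by
    refine hl.mem_of_closed (fun d _ hd => ?_) ⟨e, rfl, he⟩
    by_contra hd'
    have h8 := flow_eq_zero h6 (P := {v | ∃ d, G.tail d = v ∧ n d ≠ 0}) (fun _ _ => by positivity)
      (fun d' hd' => by
        by_contra h
        exact hd' ⟨d', rfl, fun h' => h (by simp [h'])⟩) hd hd'
    obtain ⟨d', h9, h10⟩ := hd
    exact h10 ((h5 _ _ h9.symm).trans (by exact_mod_cast h8))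
  obtain ⟨d, h8, h9⟩ := h7
  exact h9 (h2 d h8)

theorem fires_nonneg {s t : G.Divisor × G.RotorConfig q} (h : G.Fires q s t)
    (hs : ∀ v, v ≠ q → 0 ≤ s.1 v) : ∀ v, v ≠ q → 0 ≤ t.1 v := by
  classical
  obtain ⟨A, ρ, u, hu⟩ := h
  intro v hv
  have h1 := hs v hv
  simp only [Finsupp.add_apply, Finsupp.sub_apply, Finsupp.single_apply] at h1 ⊢
  by_cases huv : u.1 = v
  · rw [if_pos huv, ← huv]
    split_ifs <;> omega
  · rw [if_neg huv]
    split_ifs <;> omega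

theorem fires_basepoint {s t : G.Divisor × G.RotorConfig q} (h : G.Fires q s t) :
    s.1 q ≤ t.1 q := by
  classical
  obtain ⟨A, ρ, u, hu⟩ := h
  simp only [Finsupp.add_apply, Finsupp.sub_apply, Finsupp.single_apply, if_neg u.2]
  split_ifs <;> omega

theorem fires_degree {s t : G.Divisor × G.RotorConfig q} (h : G.Fires q s t) :
    t.1.degree = s.1.degree := by
  obtain ⟨A, ρ, u, hu⟩ := h
  simp

/-- All chips can be routed into the basepoint. -/
theorem exists_fires_terminal [Finite V] [Finite D] (hG : G.Connected) (A : G.Divisor)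
    (ρ : G.RotorConfig q) (hA : ∀ v, v ≠ q → 0 ≤ A v) :
    ∃ t, Relation.ReflTransGen (G.Fires q) (A, ρ) t ∧ ∀ v, v ≠ q → t.1 v = 0 := by
  classical
  have := Fintype.ofFinite V
  let S : Set (G.Divisor × G.RotorConfig q) := {t | Relation.ReflTransGen (G.Fires q) (A, ρ) t}
  have hS : ∀ t ∈ S, (∀ v, v ≠ q → 0 ≤ t.1 v) ∧ A q ≤ t.1 q ∧ t.1.degree = A.degree := by
    intro t ht
    induction ht with
    | refl => exact ⟨hA, le_rfl, rfl⟩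
    | tail _ h ih =>
      exact ⟨fires_nonneg h ih.1, ih.2.1.trans (fires_basepoint h),
        (fires_degree h).trans ih.2.2⟩
  -- The degree is conserved, the chips at `q` never decrease, and all other vertices stay
  -- nonnegative; this bounds every coordinate, also when `A q` is negative.
  have hfin : S.Finite := by
    have h1 : Set.Finite {f : V → ℤ | ∀ v, f v ∈ Set.Icc (min 0 (A q)) (A.degree - min 0 (A q))} :=
      Set.Finite.pi' fun _ => Set.finite_Icc _ _
    refine ((h1.preimage (DFunLike.coe_injective (F := V →₀ ℤ)).injOn).prod
      (Set.finite_univ (α := G.RotorConfig q))).subset ?_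
    intro t ht
    obtain ⟨h2, h3, h4⟩ := hS t ht
    rw [Finsupp.degree_eq_sum, ← Finset.add_sum_erase _ _ (Finset.mem_univ q)] at h4
    have h5 : 0 ≤ ∑ v ∈ Finset.univ.erase q, t.1 v :=
      Finset.sum_nonneg fun v hv => h2 v (Finset.ne_of_mem_erase hv)
    refine ⟨fun v => ?_, Set.mem_univ _⟩
    by_cases hv : v = q
    · subst hv
      exact ⟨by omega, by omega⟩
    · have h6 : t.1 v ≤ ∑ v ∈ Finset.univ.erase q, t.1 v :=
        Finset.single_le_sum (f := t.1) (fun v hv => h2 v (Finset.ne_of_mem_erase hv))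
          (Finset.mem_erase.2 ⟨hv, Finset.mem_univ _⟩)
      have h7 := h2 v hv
      exact ⟨by omega, by omega⟩
  have := hfin.to_subtype
  -- Without recurring states, reachability is a strict order on a finite set, so some reachable
  -- state admits no firing.
  let R : S → S → Prop := fun t s => Relation.TransGen (G.Fires q) s.1 t.1
  have : IsTrans S R := ⟨fun _ _ _ h h' => h'.trans h⟩
  have : Std.Irrefl R := ⟨fun s => not_fires_cycle hG s.1⟩
  obtain ⟨t, -, ht⟩ := (Finite.wellFounded_of_trans_of_irrefl R).has_min Set.univ
    ⟨⟨(A, ρ), .refl⟩, Set.mem_univ _⟩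
  refine ⟨t.1, t.2, fun v hv => ?_⟩
  by_contra h
  have h1 : 0 < t.1.1 v := lt_of_le_of_ne ((hS _ t.2).1 v hv) (Ne.symm h)
  have h2 := Fires.fire t.1.1 t.1.2 ⟨v, hv⟩ h1
  exact ht ⟨_, t.2.tail h2⟩ (Set.mem_univ _) (.single h2)

end Termination

/-! ### Final rotors form a tree. -/

section Acyclicity

variable {q : V}

/-- Every nonempty set of vertices from which the rotors do not lead out carries a chip. -/
def ChipOnCycles (s : G.Divisor × G.RotorConfig q) : Prop :=
  ∀ C : Set V, C.Nonempty → q ∉ C → (∀ v : {v : V // v ≠ q}, v.1 ∈ C → G.head (s.2 v).1 ∈ C) →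
    ∃ v ∈ C, 0 < s.1 v

/-- If the fired vertex lies in a set closed under the new rotors, its chip lands in that set.
Otherwise the set was closed before the firing and loses no chip. -/
theorem ChipOnCycles.fires {s t : G.Divisor × G.RotorConfig q} (h : G.Fires q s t)
    (hs : ∀ v, v ≠ q → 0 ≤ s.1 v) (hc : ChipOnCycles s) : ChipOnCycles t := by
  classical
  have ht := fires_nonneg h hs
  obtain ⟨A, ρ, u, hu⟩ := h
  intro C hC hq hcl
  by_cases huC : u.1 ∈ C
  · have h1 := hcl u huC
    simp only [Function.update_self] at h1
    refine ⟨_, h1, ?_⟩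
    simp only [Finsupp.add_apply, Finsupp.sub_apply, Finsupp.single_apply, if_true]
    have h2 := hs _ (fun e => hq (e ▸ h1))
    simp only at h2
    split_ifs with h3
    · rw [h3] at hu
      omega
    · omega
  · obtain ⟨v, hv, hv'⟩ := hc C hC hq fun v hv => by
      have hvu : v ≠ u := by
        rintro rfl
        exact huC hv
      have := hcl v hv
      simpa only [Function.update_of_ne hvu] using this
    refine ⟨v, hv, ?_⟩
    have huv : u.1 ≠ v := fun e => huC (e ▸ hv)
    simp only [Finsupp.add_apply, Finsupp.sub_apply, Finsupp.single_apply, if_neg huv] at hv' ⊢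
    split_ifs <;> omega

/-- The vertices whose rotor orbits miss `q` form a closed set; having no chip, it must be empty.
The number of rotor steps to `q` then serves as the height. -/
theorem ChipOnCycles.isTreeRotor {s : G.Divisor × G.RotorConfig q} (hc : ChipOnCycles s)
    (hs : ∀ v, v ≠ q → s.1 v = 0) : IsTreeRotor s.2 := by
  classical
  let f : V → V := fun v => if h : v ≠ q then G.head (s.2 ⟨v, h⟩).1 else q
  have hf : ∀ v : {v : V // v ≠ q}, f v.1 = G.head (s.2 v).1 := fun v => dif_pos v.2
  have key : ∀ v, ∃ k, f^[k] v = q := by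
    by_contra! hne
    obtain ⟨w, hw⟩ := hne
    obtain ⟨v, hv, hv'⟩ := hc {v | ∀ k, f^[k] v ≠ q} ⟨w, hw⟩ (fun h => h 0 rfl) fun v hv k => by
      have := hv (k + 1)
      rwa [Function.iterate_succ_apply, hf] at this
    exact hv'.ne' (hs v (hv 0))
  refine ⟨fun v => Nat.find (key v), fun v => ?_⟩
  have h1 := Nat.find_spec (key v)
  cases hk : Nat.find (key v) with
  | zero =>
    rw [hk] at h1
    exact absurd h1 v.2
  | succ k =>
    rw [hk, Function.iterate_succ_apply, hf] at h1
    change Nat.find _ < Nat.find _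
    rw [hk]
    exact Nat.lt_succ_of_le (Nat.find_min' (key _) h1)

theorem IsTreeRotor.chipOnCycles {ρ : G.RotorConfig q} (hρ : IsTreeRotor ρ) (A : G.Divisor) :
    ChipOnCycles (A, ρ) := by
  intro C hC hq hcl
  rw [hρ.eq_empty_of_closed hq hcl] at hC
  exact absurd hC Set.not_nonempty_empty

theorem IsTreeRotor.fires {ρ : G.RotorConfig q} (hρ : IsTreeRotor ρ) {A : G.Divisor}
    (hA : ∀ v, v ≠ q → 0 ≤ A v) {t : G.Divisor × G.RotorConfig q}
    (h : Relation.ReflTransGen (G.Fires q) (A, ρ) t) (ht : ∀ v, v ≠ q → t.1 v = 0) :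
    IsTreeRotor t.2 := by
  suffices H : (∀ v, v ≠ q → 0 ≤ t.1 v) ∧ ChipOnCycles t from H.2.isTreeRotor ht
  clear ht
  induction h with
  | refl => exact ⟨hA, hρ.chipOnCycles A⟩
  | tail _ h ih => exact ⟨fires_nonneg h ih.1, ih.2.fires h ih.1⟩

end Acyclicity

/-! ### Representatives nonnegative away from the basepoint. -/

section Representatives

/-- The divisor `v - q`. -/
noncomputable def pointDiff (G : RibbonGraph V D) (v q : V) : G.Div0 :=
  ⟨Finsupp.single v 1 - Finsupp.single q 1, G.single_sub_single_mem v q⟩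

theorem eq_sum_pointDiff [Fintype V] (q : V) (A : G.Div0) :
    A = ∑ v, (A : G.Divisor) v • G.pointDiff v q := by
  apply Subtype.ext
  have h1 : (A : G.Divisor).degree = 0 := A.2
  rw [Finsupp.degree_eq_sum] at h1
  simp only [AddSubgroup.val_finsetSum, AddSubgroup.coe_zsmul, pointDiff, smul_sub,
    Finset.sum_sub_distrib, ← Finset.sum_smul, h1, zero_smul, sub_zero]
  conv_lhs => rw [← Finsupp.univ_sum_single (A : G.Divisor)]
  simp

variable [Fintype D]

theorem divClass_add (A B : G.Div0) : G.divClass (A + B) = G.divClass A + G.divClass B := rfl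

theorem divClass_eq_zero {A : G.Div0} :
    G.divClass A = 0 ↔ A ∈ AddSubgroup.closure (Set.range G.lend) :=
  QuotientAddGroup.eq_zero_iff A

theorem divClass_sum {ι : Type*} (s : Finset ι) (A : ι → G.Div0) :
    G.divClass (∑ i ∈ s, A i) = ∑ i ∈ s, G.divClass (A i) :=
  map_sum (QuotientAddGroup.mk' _) A s

theorem divClass_zsmul (n : ℤ) (A : G.Div0) : G.divClass (n • A) = n • G.divClass A := rfl

theorem divClass_lend (v : V) : G.divClass (G.lend v) = 0 :=
  divClass_eq_zero.2 (AddSubgroup.subset_closure ⟨v, rfl⟩)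

/-- The classes of the divisors of degree zero that are nonnegative away from `q`. -/
noncomputable def nonnegClasses (G : RibbonGraph V D) (q : V) : AddSubmonoid G.Jac where
  carrier := {c | ∃ A : G.Div0, G.divClass A = c ∧ ∀ v, v ≠ q → 0 ≤ (A : G.Divisor) v}
  zero_mem' := ⟨0, rfl, by simp⟩
  add_mem' := by
    rintro _ _ ⟨A, rfl, hA⟩ ⟨B, rfl, hB⟩
    exact ⟨A + B, rfl, fun v hv => add_nonneg (hA v hv) (hB v hv)⟩

theorem pointDiff_mem_nonnegClasses (q v : V) :
    G.divClass (G.pointDiff v q) ∈ G.nonnegClasses q := by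
  classical
  refine ⟨_, rfl, fun u hu => ?_⟩
  simp only [pointDiff, Finsupp.sub_apply, Finsupp.single_apply, if_neg (Ne.symm hu)]
  split_ifs <;> simp

/-- The property spreads along a walk from `q`. Lending at the tail of `e` expresses `-(head e - q)`
as the sum of the `head d - q` over the other darts `d` there, plus copies of `-(tail e - q)`. -/
theorem neg_pointDiff_mem_nonnegClasses (hG : G.Connected) (q v : V) :
    - G.divClass (G.pointDiff v q) ∈ G.nonnegClasses q := by
  classical
  obtain ⟨l, hl⟩ := hG.2 q v
  refine hl.mem_of_closed (U := {v | - G.divClass (G.pointDiff v q) ∈ G.nonnegClasses q})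
    (fun e _ he => ?_) ?_
  · have h1 : G.divClass (G.lend (G.tail e)) = ∑ d with G.tail d = G.tail e,
        (G.divClass (G.pointDiff (G.head d) q) + - G.divClass (G.pointDiff (G.tail e) q)) := by
      rw [lend, divClass_sum]
      refine Finset.sum_congr (by ext; simp) fun d hd => ?_
      rw [← (Finset.mem_filter.1 hd).2]
      change _ = G.divClass (G.pointDiff (G.head d) q + - G.pointDiff (G.tail d) q)
      congr 1
      apply Subtype.ext
      simp [bd, pointDiff]
    have he' : e ∈ Finset.univ.filter fun d => G.tail d = G.tail e := by simp
    rw [divClass_lend, Finset.sum_add_distrib, ← Finset.add_sum_erase _ _ he', add_assoc] at h1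
    rw [Set.mem_ofPred_eq, neg_eq_of_add_eq_zero_right h1.symm]
    exact add_mem (sum_mem fun d _ => pointDiff_mem_nonnegClasses q _) (sum_mem fun d _ => he)
  · have : G.pointDiff q q = 0 := Subtype.ext (by simp [pointDiff])
    rw [Set.mem_ofPred_eq, this]
    change -(0 : G.Jac) ∈ _
    rw [neg_zero]
    exact zero_mem _

theorem exists_nonneg_representative [Finite V] (hG : G.Connected) (q : V) (c : G.Jac) :
    ∃ A : G.Div0, G.divClass A = c ∧ ∀ v, v ≠ q → 0 ≤ (A : G.Divisor) v := by
  have := Fintype.ofFinite V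
  change c ∈ G.nonnegClasses q
  obtain ⟨A, rfl⟩ := QuotientAddGroup.mk_surjective c
  change G.divClass A ∈ _
  rw [eq_sum_pointDiff q A, divClass_sum]
  refine sum_mem fun v _ => ?_
  rw [divClass_zsmul]
  obtain ⟨n, hn | hn⟩ := Int.eq_nat_or_neg ((A : G.Divisor) v)
  · rw [hn, natCast_zsmul]
    exact nsmul_mem (pointDiff_mem_nonnegClasses q v) n
  · rw [hn, neg_smul, natCast_zsmul, ← neg_nsmul]
    exact nsmul_mem (neg_pointDiff_mem_nonnegClasses hG q v) n

end Representatives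

end RibbonGraph

/-! ### Rotor potentials and well-definedness. -/

namespace RibbonGraph

/-- If `f` is the increment of `r` along the permutation `π`, then the difference of two values of
`r` on a cycle of `π` is the sum of `f` over the arc between them. -/
theorem exists_arc {D J : Type*} [Finite D] [AddCommGroup J] {π : Equiv.Perm D} {f r : D → J}
    (hr : ∀ d, r (π d) = r d + f (π d)) {d d' : D} (h : π.SameCycle d d') :
    ∃ B : Finset D, (∀ e ∈ B, π.SameCycle d e) ∧ r d' - r d = ∑ e ∈ B, f e ∧
      (d = d' → B = ∅) ∧ (d ≠ d' → d ∉ B ∧ d' ∈ B) := by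
  classical
  have hk : ∃ k : ℕ, (π ^ k) d = d' := h.exists_nat_pow_eq
  set k := Nat.find hk with hkdef
  have hspec : (π ^ k) d = d' := Nat.find_spec hk
  have hmin : ∀ m < k, (π ^ m) d ≠ d' := fun m hm => Nat.find_min hk hm
  have hinj : ∀ i j, i < j → j ≤ k → (π ^ i) d ≠ (π ^ j) d := by
    intro i j hij hj he
    refine hmin (i + (k - j)) (by omega) ?_
    rw [add_comm, pow_add, Equiv.Perm.mul_apply, he, ← Equiv.Perm.mul_apply, ← pow_add,
      Nat.sub_add_cancel hj, hspec]
  have hsum : ∀ m, r ((π ^ m) d) - r d = ∑ j ∈ Finset.range m, f ((π ^ (j + 1)) d) := by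
    intro m
    induction m with
    | zero => simp
    | succ m ih =>
      rw [Finset.sum_range_succ, ← ih, pow_succ', Equiv.Perm.mul_apply, hr]
      abel
  refine ⟨(Finset.range k).image fun j => (π ^ (j + 1)) d, ?_, ?_, ?_, ?_⟩
  · intro e he
    obtain ⟨j, -, rfl⟩ := Finset.mem_image.1 he
    exact ⟨(j + 1 : ℕ), by rw [zpow_natCast]⟩
  · rw [Finset.sum_image, ← hsum, hspec]
    intro i hi j hj hij
    simp only [Finset.coe_range, Set.mem_Iio] at hi hj
    by_contra hne
    rcases Nat.lt_or_gt_of_ne hne with h1 | h1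
    · exact hinj (i + 1) (j + 1) (by omega) (by omega) hij
    · exact hinj (j + 1) (i + 1) (by omega) (by omega) hij.symm
  · intro he
    have : k = 0 := by
      rw [hkdef, Nat.find_eq_zero]
      exact he
    simp [this]
  · intro hne
    have hk0 : k ≠ 0 := fun h0 => hne (by rw [← hspec, h0, pow_zero, Equiv.Perm.one_apply])
    constructor
    · intro hd
      obtain ⟨j, hj, he⟩ := Finset.mem_image.1 hd
      exact hinj 0 (j + 1) (by omega) (Finset.mem_range.1 hj) (by simpa using he.symm)
    · refine Finset.mem_image.2 ⟨k - 1, Finset.mem_range.2 (by omega), ?_⟩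
      rw [Nat.sub_add_cancel (by omega), hspec]

variable {V D : Type*} {G : RibbonGraph V D} [Fintype D] {q : V}

/-- A potential on the darts that increases by the class of an edge whenever the rotor advances to
that edge. -/
def IsRotorPotential (r : D → G.Jac) : Prop :=
  ∀ d, r (G.next d) = r d + G.divClass (G.bd (G.next d))

/-- The potential of a rotor configuration determines it among the trees. -/
theorem IsRotorPotential.rotor_unique [Finite V] [Fintype {v : V // v ≠ q}] {r : D → G.Jac}
    (hr : IsRotorPotential r) {ρ ρ' : G.RotorConfig q} (hρ : IsTreeRotor ρ)
    (hρ' : IsTreeRotor ρ') (h : ∑ v, r (ρ v).1 = ∑ v, r (ρ' v).1) : ρ = ρ' := by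
  classical
  have := Fintype.ofFinite V
  choose B hB1 hB2 hB3 hB4 using fun v : {v : V // v ≠ q} =>
    exists_arc (f := fun e => G.divClass (G.bd e)) hr
      (G.sameCycle_next (ρ v).1 (ρ' v).1 ((ρ v).2.trans (ρ' v).2.symm))
  have htail : ∀ v, ∀ e ∈ B v, G.tail e = v := fun v e he =>
    (tail_eq_of_sameCycle (hB1 v e he)).trans (ρ v).2
  let S : Finset D := Finset.univ.biUnion B
  have hS : ∀ v : {v : V // v ≠ q}, ∀ d, G.tail d = v → (d ∈ S ↔ d ∈ B v) := by
    intro v d hd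
    simp only [S, Finset.mem_biUnion, Finset.mem_univ, true_and]
    constructor
    · rintro ⟨u, hu⟩
      obtain rfl : u = v := Subtype.ext ((htail u d hu).symm.trans hd)
      exact hu
    · exact fun h => ⟨v, h⟩
  have hSq : ∀ d ∈ S, G.tail d ≠ q := by
    intro d hd
    simp only [S, Finset.mem_biUnion, Finset.mem_univ, true_and] at hd
    obtain ⟨u, hu⟩ := hd
    exact htail u d hu ▸ u.2
  have h1 : G.divClass (∑ d ∈ S, G.bd d) = 0 := by
    rw [divClass_sum, Finset.sum_biUnion]
    · rw [Finset.sum_congr rfl fun v _ => (hB2 v).symm, Finset.sum_sub_distrib, h, sub_self]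
    · intro u _ v _ huv
      refine Finset.disjoint_left.2 fun d hd hd' => huv ?_
      exact Subtype.ext ((htail u d hd).symm.trans (htail v d hd'))
  rw [divClass_eq_zero] at h1
  obtain ⟨m, hm⟩ := AddSubgroup.mem_closure_range_iff_of_fintype.1 h1
  -- Equal potentials make the boundary of the arcs `S` a combination of lending moves; subtracting
  -- these leaves a conserved flow. The shift by `m q` is harmless by `sum_bd` and makes `x` vanish
  -- at `q`.
  let x : D → ℤ := fun d => (if d ∈ S then 1 else 0) - (m (G.tail d) - m q)
  have hx : ∑ d, x d • G.bd d = 0 := by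
    simp only [x, sub_smul, Finset.sum_sub_distrib, ← Finset.smul_sum, sum_bd, smul_zero,
      sub_zero]
    rw [← sum_zsmul_lend, ← hm]
    simp [ite_smul]
  have hxq : ∀ d, G.tail d = q → x d = 0 := by
    intro d hd
    have : d ∉ S := fun h => hSq d h hd
    simp [x, this, hd]
  -- The values of `x` at one vertex differ by at most one. The arc from `ρ v` to `ρ' v` omits its
  -- start and contains its end, so the maximum is at `ρ' v` and the minimum at `ρ v`.
  have hx1 : ∀ v d, G.tail d = v.1 → x d ≤ x (ρ' v).1 ∧ x (ρ' v).1 ≤ x d + 1 := by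
    intro v d hd
    simp only [x, hS v d hd, hS v _ (ρ' v).2, hd, (ρ' v).2]
    by_cases he : (ρ v).1 = (ρ' v).1
    · simp [hB3 v he]
    · rw [if_pos (hB4 v he).2]
      split_ifs <;> constructor <;> omega
  have hx2 : ∀ v d, G.tail d = v.1 → x (ρ v).1 ≤ x d ∧ x d ≤ x (ρ v).1 + 1 := by
    intro v d hd
    simp only [x, hS v d hd, hS v _ (ρ v).2, hd, (ρ v).2]
    by_cases he : (ρ v).1 = (ρ' v).1
    · simp [hB3 v he]
    · rw [if_neg (hB4 v he).1]
      split_ifs <;> constructor <;> omega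
  -- A rotor of `ρ'` with positive flow cannot leave this set, since the flow vanishes on darts
  -- leading out. So the set is closed under `ρ'`, hence empty.
  have hP : {v | ∃ h : v ≠ q, 0 < x (ρ' ⟨v, h⟩).1} = ∅ := by
    refine hρ'.eq_empty_of_closed (fun ⟨h, _⟩ => h rfl) fun v hv => ?_
    by_contra hv'
    have h0 := flow_eq_zero hx (P := {v | ∃ h : v ≠ q, 0 < x (ρ' ⟨v, h⟩).1}) (d := (ρ' v).1)
      (fun d ⟨h, hd⟩ => by
        have := (hx1 ⟨G.tail d, h⟩ d rfl).2
        omega)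
      (fun d hd => by
        by_cases hq : G.tail d = q
        · exact (hxq d hq).le
        · have := (hx1 ⟨G.tail d, hq⟩ d rfl).1
          by_contra h
          exact hd ⟨hq, by omega⟩)
      ((ρ' v).2.symm ▸ hv) hv'
    exact absurd hv.2 (by rw [h0]; exact lt_irrefl _)
  have hN : {v | ∃ h : v ≠ q, x (ρ ⟨v, h⟩).1 < 0} = ∅ := by
    refine hρ.eq_empty_of_closed (fun ⟨h, _⟩ => h rfl) fun v hv => ?_
    by_contra hv'
    have h0 := flow_eq_zero (x := -x) (by simpa using hx)
      (P := {v | ∃ h : v ≠ q, x (ρ ⟨v, h⟩).1 < 0}) (d := (ρ v).1)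
      (fun d ⟨h, hd⟩ => by
        have := (hx2 ⟨G.tail d, h⟩ d rfl).2
        rw [Pi.neg_apply]
        omega)
      (fun d hd => by
        rw [Pi.neg_apply]
        by_cases hq : G.tail d = q
        · rw [hxq d hq, neg_zero]
        · have := (hx2 ⟨G.tail d, hq⟩ d rfl).1
          by_contra h
          exact hd ⟨hq, by omega⟩)
      ((ρ v).2.symm ▸ hv) hv'
    have h2 := hv.2
    rw [Pi.neg_apply, neg_eq_zero] at h0
    exact absurd h2 (by rw [h0]; exact lt_irrefl _)
  funext v
  apply Subtype.ext
  by_contra he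
  have h2 : ¬ 0 < x (ρ' v).1 := fun h => by
    have : v.1 ∈ {v | ∃ h : v ≠ q, 0 < x (ρ' ⟨v, h⟩).1} := ⟨v.2, h⟩
    rw [hP] at this
    exact this
  have h3 : ¬ x (ρ v).1 < 0 := fun h => by
    have : v.1 ∈ {v | ∃ h : v ≠ q, x (ρ ⟨v, h⟩).1 < 0} := ⟨v.2, h⟩
    rw [hN] at this
    exact this
  -- If the rotors differed, `x (ρ' v)` would be `x (ρ v) + 1`, against `x (ρ' v) ≤ 0 ≤ x (ρ v)`.
  simp only [x, hS v _ (ρ v).2, hS v _ (ρ' v).2, (ρ v).2, (ρ' v).2, if_neg (hB4 v he).1,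
    if_pos (hB4 v he).2] at h2 h3
  omega

/-- Routing the chips of a class changes the potential of the rotors by that class. -/
theorem IsRotorPotential.routesTo [Finite V] [Fintype {v : V // v ≠ q}] {r : D → G.Jac}
    (hr : IsRotorPotential r) {c : G.Jac} {ρ ρ' : G.RotorConfig q} (h : G.RoutesTo q c ρ ρ') :
    ∑ v, r (ρ' v).1 = ∑ v, r (ρ v).1 - c := by
  classical
  have := Fintype.ofFinite V
  obtain ⟨A, rfl, hA, A', hf, hA'⟩ := h
  -- Invariant: the rotor sum minus the class of the chips. At the end the divisor vanishes away
  -- from `q` and has degree zero, so it is zero.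
  have key : ∀ t, Relation.ReflTransGen (G.Fires q) ((A : G.Divisor), ρ) t →
      ∃ A' : G.Div0, A' = t.1 ∧
        ∑ v, r (t.2 v).1 = ∑ v, r (ρ v).1 - G.divClass A + G.divClass A' := by
    intro t ht
    induction ht with
    | refl => exact ⟨A, rfl, by abel⟩
    | tail _ hstep ih =>
      obtain ⟨C, τ, u, hu⟩ := hstep
      obtain ⟨C', rfl, h1⟩ := ih
      refine ⟨C' + G.bd (G.next (τ u).1), ?_, ?_⟩
      · simp only [AddSubgroup.coe_add, bd, advance, G.tail_next, (τ u).2]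
        abel
      · rw [divClass_add, ← add_assoc, ← h1, ← sub_eq_iff_eq_add', ← Finset.sum_sub_distrib,
          Finset.sum_eq_single u]
        · simp only [Function.update_self, advance]
          rw [hr]
          abel
        · intro v _ hv
          simp [Function.update_of_ne hv]
        · simp
  obtain ⟨C, h1, h2⟩ := key _ hf
  have h3 : C = 0 := by
    rw [eq_sum_pointDiff q C]
    refine Finset.sum_eq_zero fun v _ => ?_
    by_cases hv : v = q
    · have : G.pointDiff v q = 0 := Subtype.ext (by simp [pointDiff, hv])
      rw [this, smul_zero]
    · rw [h1, hA' v hv, zero_smul]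
  rw [h2, h3]
  exact add_zero _

theorem exists_routesTo [Finite V] (hG : G.Connected) (c : G.Jac) {ρ : G.RotorConfig q} :
    ∃ ρ', G.RoutesTo q c ρ ρ' := by
  obtain ⟨A, h1, h2⟩ := exists_nonneg_representative hG q c
  obtain ⟨t, h3, h4⟩ := exists_fires_terminal hG A ρ h2
  exact ⟨t.2, A, h1, h2, t.1, h3, h4⟩

theorem IsTreeRotor.routesTo {c : G.Jac} {ρ ρ' : G.RotorConfig q} (hρ : IsTreeRotor ρ)
    (h : G.RoutesTo q c ρ ρ') : IsTreeRotor ρ' := by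
  obtain ⟨A, -, h2, A', h3, h4⟩ := h
  exact hρ.fires h2 h3 h4

/-- The fallback value in `rotorAction` never occurs. -/
theorem routesTo_rotorAction [Finite V] (hG : G.Connected) (c : G.Jac) (T : G.SpanningTree) :
    G.RoutesTo q c (T.rotor q) ((G.rotorAction q c T).rotor q) := by
  have h : ∃ T' : G.SpanningTree, G.RoutesTo q c (T.rotor q) (T'.rotor q) := by
    obtain ⟨ρ', h⟩ := exists_routesTo hG c (ρ := T.rotor q)
    have hρ' := (T.isTreeRotor q).routesTo h
    exact ⟨treeOfRotor ρ' hρ', by rwa [rotor_treeOfRotor]⟩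
  rw [rotorAction, dif_pos h]
  exact h.choose_spec

theorem IsRotorPotential.rotorActionWellDefined [Finite V] {r : D → G.Jac}
    (hr : IsRotorPotential r) (hG : G.Connected) (q : V) : G.RotorActionWellDefined q := by
  have := Fintype.ofFinite {v : V // v ≠ q}
  intro c T ρ'
  have h0 := routesTo_rotorAction hG c T (q := q)
  constructor
  · intro h
    refine hr.rotor_unique ((T.isTreeRotor q).routesTo h) (SpanningTree.isTreeRotor _ q) ?_
    rw [hr.routesTo h, hr.routesTo h0]
  · rintro rfl
    exact h0

end RibbonGraph

namespace RibbonGraph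

/-! ### Chains, cycles, cuts and the boundary isomorphism. -/

section Chains

variable {V D : Type*} {G : RibbonGraph V D}

theorem edge_rev (d : D) : G.edge (G.rev d) = - G.edge d := by
  rw [eq_neg_iff_add_eq_zero, add_comm]
  exact (QuotientAddGroup.eq_zero_iff _).2 (AddSubgroup.subset_closure ⟨d, rfl⟩)

theorem closure_edge : AddSubgroup.closure (Set.range G.edge) = ⊤ := by
  rw [eq_top_iff]
  intro x _
  obtain ⟨f, rfl⟩ := QuotientAddGroup.mk_surjective x
  induction f using Finsupp.induction_linear with
  | zero => exact zero_mem _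
  | add f g hf hg => exact add_mem (hf trivial) (hg trivial)
  | single d n =>
    have h1 : (QuotientAddGroup.mk (Finsupp.single d n) : G.ZE) = n • G.edge d := by
      rw [edge, ← QuotientAddGroup.mk_zsmul, Finsupp.smul_single, smul_eq_mul, mul_one]
    rw [h1]
    exact zsmul_mem (AddSubgroup.subset_closure (Set.mem_range_self d)) n

theorem eq_top_of_edge_mem {N : AddSubgroup G.ZE} (h : ∀ d, G.edge d ∈ N) : N = ⊤ := by
  rw [eq_top_iff, ← closure_edge, AddSubgroup.closure_le]
  rintro _ ⟨d, rfl⟩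
  exact h d

/-- The homomorphism on chains with prescribed values on the oriented edges. -/
noncomputable def liftZE {A : Type*} [AddCommGroup A] (f : D → A)
    (hf : ∀ d, f (G.rev d) = - f d) : G.ZE →+ A :=
  QuotientAddGroup.lift _ (Finsupp.liftAddHom fun d => zmultiplesHom A (f d)) (by
    rw [AddSubgroup.closure_le]
    rintro _ ⟨d, rfl⟩
    simp [AddMonoidHom.mem_ker, hf])

theorem liftZE_edge {A : Type*} [AddCommGroup A] (f : D → A) (hf : ∀ d, f (G.rev d) = - f d)
    (d : D) : liftZE (G := G) f hf (G.edge d) = f d := by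
  simp [liftZE, edge]

/-- If every chain is, modulo a group `N` of chains, supported on a tree, then every chain without
boundary lies in `N`. -/
theorem IsTreeRotor.ker_boundaryZE_le [Finite V] {q : V} {ρ : G.RotorConfig q}
    (hρ : IsTreeRotor ρ) {N : AddSubgroup G.ZE} (hN : N ≤ G.boundaryZE.ker)
    (h : ∀ d, G.edge d ∈ N ⊔ AddSubgroup.closure (Set.range fun v => G.edge (ρ v).1)) :
    G.boundaryZE.ker ≤ N := by
  have := Fintype.ofFinite {v : V // v ≠ q}
  intro x hx
  have h1 : x ∈ N ⊔ AddSubgroup.closure (Set.range fun v => G.edge (ρ v).1) := by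
    rw [eq_top_of_edge_mem h]
    trivial
  obtain ⟨y, hy, z, hz, rfl⟩ := AddSubgroup.mem_sup.1 h1
  obtain ⟨c, rfl⟩ := AddSubgroup.mem_closure_range_iff_of_fintype.1 hz
  rw [AddMonoidHom.mem_ker, map_add, AddMonoidHom.mem_ker.1 (hN hy), zero_add, map_sum] at hx
  simp only [map_zsmul, boundaryZE_edge] at hx
  rw [hρ.eq_zero_of_sum_bd hx]
  simpa using hy

theorem edge_mem_closure_rotor {q : V} {ρ : G.RotorConfig q} {d : D} (hd : d ∈ rotorEdges ρ) :
    G.edge d ∈ AddSubgroup.closure (Set.range fun v => G.edge (ρ v).1) := by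
  obtain ⟨v, rfl | rfl⟩ := hd
  · exact AddSubgroup.subset_closure ⟨v, rfl⟩
  · rw [edge_rev]
    exact neg_mem (AddSubgroup.subset_closure ⟨v, rfl⟩)

theorem cycleSpace_le : G.cycleSpace ≤ G.boundaryZE.ker := G.boundaryZE_cycleSpace

theorem Connected.exists_treeRotor (hG : G.Connected) (q : V) :
    ∃ ρ : G.RotorConfig q, IsTreeRotor ρ := by
  obtain ⟨ρ, h, -⟩ := RibbonGraph.exists_treeRotor (G := G) (q := q) (E := Set.univ) fun v =>
    let ⟨l, hl⟩ := hG.2 v q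
    ⟨l, hl, fun _ _ => trivial⟩
  exact ⟨ρ, h⟩

theorem Connected.ker_boundaryZE [Finite V] (hG : G.Connected) :
    G.boundaryZE.ker = G.cycleSpace := by
  refine le_antisymm ?_ cycleSpace_le
  obtain ⟨q⟩ := hG.1
  obtain ⟨ρ, hρ⟩ := hG.exists_treeRotor q
  refine hρ.ker_boundaryZE_le cycleSpace_le fun d => ?_
  by_cases hd : d ∈ rotorEdges ρ
  · exact AddSubgroup.mem_sup_right (edge_mem_closure_rotor hd)
  -- The fundamental cycle of a non-tree edge expresses this edge by tree edges.
  · obtain ⟨l, hl, hl'⟩ := hρ.exists_path (G.head d) (G.tail d)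
    have hc := hl.isCycle (fun h => hd (hl' _ h)) fun h => hd (rev_mem_rotorEdges.1 (hl' _ h))
    have h1 : ((d :: l).map G.edge).sum ∈ G.cycleSpace :=
      AddSubgroup.subset_closure ⟨_, _, hc, rfl⟩
    rw [List.map_cons, List.sum_cons] at h1
    have h2 : (l.map G.edge).sum ∈
        AddSubgroup.closure (Set.range fun v => G.edge (ρ v).1) := by
      refine list_sum_mem fun x hx => ?_
      obtain ⟨e, he, rfl⟩ := List.mem_map.1 hx
      exact edge_mem_closure_rotor (hl' e he)
    rw [← add_sub_cancel_right (G.edge d) (l.map G.edge).sum]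
    exact sub_mem (AddSubgroup.mem_sup_left h1) (AddSubgroup.mem_sup_right h2)

/-- An antisymmetric function on the darts that vanishes on chains without boundary is the
coboundary of a function on the vertices. -/
theorem Connected.exists_potential (hG : G.Connected) {A : Type*} [AddCommGroup A] (g : G.ZE →+ A)
    (hg : G.boundaryZE.ker ≤ g.ker) :
    ∃ a : V → A, ∀ d, g (G.edge d) = a (G.head d) - a (G.tail d) := by
  obtain ⟨q⟩ := hG.1
  choose l hl using hG.2 q
  refine ⟨fun v => g ((l v).map G.edge).sum, fun d => ?_⟩
  rw [← map_sub, ← sub_eq_zero, ← map_sub]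
  refine hg (AddMonoidHom.mem_ker.2 (Subtype.ext ?_))
  rw [map_sub, map_sub, AddSubgroup.coe_sub, AddSubgroup.coe_sub, boundaryZE_walk _ _ _ _ (hl _),
    boundaryZE_walk _ _ _ _ (hl _), boundaryZE_edge, bd]
  simp

theorem boundaryZE_surjective [Finite V] (hG : G.Connected) : Function.Surjective G.boundaryZE := by
  obtain ⟨q⟩ := hG.1
  intro A
  change A ∈ G.boundaryZE.range
  have h1 : ∀ v, G.pointDiff v q ∈ G.boundaryZE.range := fun v => by
    obtain ⟨l, hl⟩ := hG.2 q v
    exact ⟨_, Subtype.ext (boundaryZE_walk _ _ _ _ hl)⟩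
  have := Fintype.ofFinite V
  rw [eq_sum_pointDiff q A]
  exact sum_mem fun v _ => zsmul_mem (h1 v) _

variable [Fintype D]

open Classical in
theorem sum_fiber {M : Type*} [AddCommGroup M] {f : D → M} (hf : ∀ d, f (G.rev d) = - f d)
    (U : Set V) :
    ∑ d with G.tail d ∈ U, f d = ∑ d with G.tail d ∈ U ∧ G.head d ∉ U, f d := by
  have h2 : ∑ d with G.tail d ∈ U ∧ G.head d ∈ U, f d = 0 := by
    apply Finset.sum_involution (fun d _ => G.rev d)
    · intro d _
      simp [hf]
    · intro d _ _
      exact G.rev_ne d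
    · intro d hd
      simp only [Finset.mem_filter, Finset.mem_univ, true_and, head_rev] at hd ⊢
      exact ⟨hd.2, hd.1⟩
    · intro d _
      exact G.rev_rev d
  rw [← Finset.sum_filter_add_sum_filter_not _ (fun d => G.head d ∈ U), Finset.filter_filter,
    Finset.filter_filter, h2, zero_add]

open Classical in
theorem sum_tail_mem [Fintype V] {M : Type*} [AddCommMonoid M] (f : D → M) (U : Set V) :
    ∑ d with G.tail d ∈ U, f d = ∑ v with v ∈ U, ∑ d with G.tail d = v, f d := by
  rw [← Finset.sum_fiberwise_of_maps_to (s := Finset.univ.filter fun d => G.tail d ∈ U)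
    (t := Finset.univ.filter fun v => v ∈ U) (g := G.tail) (by simp)]
  refine Finset.sum_congr rfl fun v hv => Finset.sum_congr ?_ fun _ _ => rfl
  ext d
  simp only [Finset.mem_filter, Finset.mem_univ, true_and] at hv ⊢
  constructor
  · exact fun h => h.2
  · exact fun h => ⟨h ▸ hv, h⟩

open Classical in
theorem cut_eq_sum_tail (U : Set V) : G.cut U = ∑ d with G.tail d ∈ U, G.edge d :=
  (sum_fiber edge_rev U).symm

theorem sum_edgeClass_eq_zero {S : Finset D}
    (h : ∑ d ∈ S, G.edge d ∈ G.cycleSpace ⊔ G.cutSpace) : ∑ d ∈ S, G.edgeClass d = 0 := by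
  have h1 := map_sum (QuotientAddGroup.mk' (G.cycleSpace ⊔ G.cutSpace)) G.edge S
  exact h1.symm.trans ((QuotientAddGroup.eq_zero_iff _).2 h)

open Classical in
theorem sum_edgeClass (v : V) : ∑ d with G.tail d = v, G.edgeClass d = 0 := by
  apply sum_edgeClass_eq_zero
  have h1 : G.cut {v} ∈ G.cycleSpace ⊔ G.cutSpace :=
    AddSubgroup.mem_sup_right (AddSubgroup.subset_closure ⟨_, rfl⟩)
  rwa [cut_eq_sum_tail] at h1

/-- A homomorphism that vanishes on cycles and on cuts factors through the edge group. -/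
noncomputable def liftEdgeGroup {A : Type*} [AddCommGroup A] (g : G.ZE →+ A)
    (h : G.cycleSpace ⊔ G.cutSpace ≤ g.ker) : G.EdgeGroup →+ A :=
  QuotientAddGroup.lift _ g h

theorem liftEdgeGroup_edgeClass {A : Type*} [AddCommGroup A] (g : G.ZE →+ A)
    (h : G.cycleSpace ⊔ G.cutSpace ≤ g.ker) (d : D) :
    liftEdgeGroup g h (G.edgeClass d) = g (G.edge d) := rfl

theorem edgeGroup_hom_ext {A : Type*} [AddCommGroup A] {g g' : G.EdgeGroup →+ A}
    (h : ∀ d, g (G.edgeClass d) = g' (G.edgeClass d)) : g = g' := by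
  refine AddMonoidHom.ext fun x => ?_
  obtain ⟨y, rfl⟩ := QuotientAddGroup.mk_surjective x
  have h1 : ((g - g').comp (QuotientAddGroup.mk' (G.cycleSpace ⊔ G.cutSpace))).ker = ⊤ :=
      eq_top_of_edge_mem fun d => by
    rw [AddMonoidHom.mem_ker]
    exact sub_eq_zero.2 (h d)
  have h2 : y ∈ ((g - g').comp (QuotientAddGroup.mk' (G.cycleSpace ⊔ G.cutSpace))).ker := by
    rw [h1]
    trivial
  exact sub_eq_zero.1 (AddMonoidHom.mem_ker.1 h2)

theorem boundaryZE_cut_singleton (v : V) : G.boundaryZE (G.cut {v}) = G.lend v := by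
  classical
  rw [cut_eq_sum_tail, map_sum, lend]
  exact Finset.sum_congr (by ext; simp) fun d _ => boundaryZE_edge G d

/-- Lending moves are the boundaries of vertex cuts, and chains without boundary are cycles. So a
chain with trivial class in `Jac` is a cycle plus cuts. -/
theorem boundary_bijective [Finite V] (hG : G.Connected) : Function.Bijective G.boundary := by
  constructor
  · rw [injective_iff_map_eq_zero]
    intro x hx
    obtain ⟨y, rfl⟩ := QuotientAddGroup.mk_surjective x
    have h1 : G.boundaryZE y ∈ AddSubgroup.closure (Set.range G.lend) :=
      (QuotientAddGroup.eq_zero_iff _).1 hx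
    have h2 : AddSubgroup.closure (Set.range G.lend) ≤ G.cutSpace.map G.boundaryZE := by
      rw [AddSubgroup.closure_le]
      rintro _ ⟨v, rfl⟩
      exact ⟨_, AddSubgroup.subset_closure ⟨{v}, rfl⟩, boundaryZE_cut_singleton v⟩
    obtain ⟨z, hz, hz'⟩ := h2 h1
    have h3 : y - z ∈ G.cycleSpace := by
      rw [← hG.ker_boundaryZE, AddMonoidHom.mem_ker, map_sub, hz', sub_self]
    rw [QuotientAddGroup.eq_zero_iff, ← sub_add_cancel y z]
    exact add_mem (AddSubgroup.mem_sup_left h3) (AddSubgroup.mem_sup_right hz)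
  · intro c
    obtain ⟨A, rfl⟩ := QuotientAddGroup.mk_surjective c
    obtain ⟨y, rfl⟩ := boundaryZE_surjective hG A
    exact ⟨QuotientAddGroup.mk y, rfl⟩

end Chains

end RibbonGraph

namespace RibbonGraph

/-! ### Integrating a function along a permutation. -/

/-- A function whose sum over every cycle of a permutation vanishes is the increment of another
function along the permutation. -/
theorem exists_increment {D J : Type*} [Finite D] [AddCommGroup J] {π : Equiv.Perm D} {f : D → J}
    (h : ∀ (d : D) (S : Finset D), (∀ e, e ∈ S ↔ π.SameCycle d e) → ∑ e ∈ S, f e = 0) :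
    ∃ r : D → J, ∀ d, r (π d) = r d + f (π d) := by
  classical
  let b : D → D := fun x => (Quotient.mk (Equiv.Perm.SameCycle.setoid π) x).out
  have hb : ∀ x, π.SameCycle (b x) x := fun x =>
    Quotient.exact (s := Equiv.Perm.SameCycle.setoid π) (Quotient.out_eq _)
  have hbπ : ∀ x, b (π x) = b x := fun x => by
    have : Quotient.mk (Equiv.Perm.SameCycle.setoid π) (π x) = Quotient.mk _ x :=
      Quotient.sound (s := Equiv.Perm.SameCycle.setoid π)
        (Equiv.Perm.sameCycle_apply_left.2 (Equiv.Perm.SameCycle.refl _ _))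
    simp only [b, this]
  have hk : ∀ x, ∃ k : ℕ, (π ^ k) (b x) = x := fun x => (hb x).exists_nat_pow_eq
  let k : D → ℕ := fun x => Nat.find (hk x)
  have hspec : ∀ x, (π ^ k x) (b x) = x := fun x => Nat.find_spec (hk x)
  have hmin : ∀ x m, (π ^ m) (b x) = x → k x ≤ m := fun x m hm => Nat.find_min' (hk x) hm
  refine ⟨fun x => ∑ j ∈ Finset.range (k x), f ((π ^ (j + 1)) (b x)), fun x => ?_⟩
  have h1 : (π ^ (k x + 1)) (b x) = π x := by
    rw [pow_succ', Equiv.Perm.mul_apply, hspec]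
  have h2 : ∑ j ∈ Finset.range (k x), f ((π ^ (j + 1)) (b x)) + f (π x) =
      ∑ j ∈ Finset.range (k x + 1), f ((π ^ (j + 1)) (b x)) := by
    rw [Finset.sum_range_succ, h1]
  simp only [hbπ]
  rw [h2]
  -- `r` is the partial sum from the base point of the cycle. Only the step back to the base point
  -- needs the hypothesis: there the full sum must match `r = 0`.
  by_cases hx : π x = b x
  · have h3 : k (π x) = 0 := Nat.le_zero.1 (hmin _ 0 (by rw [hbπ, hx]; rfl))
    rw [h3, Finset.range_zero, Finset.sum_empty]
    have hinj : ∀ i j, i < j → j ≤ k x → (π ^ (i + 1)) (b x) ≠ (π ^ (j + 1)) (b x) := by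
      intro i j hij hj he
      rw [pow_succ', pow_succ', Equiv.Perm.mul_apply, Equiv.Perm.mul_apply] at he
      have h4 : (π ^ (k x - j + i)) (b x) = x := by
        rw [pow_add, Equiv.Perm.mul_apply, π.injective he, ← Equiv.Perm.mul_apply, ← pow_add,
          Nat.sub_add_cancel hj, hspec]
      have := hmin _ _ h4
      omega
    rw [← h (b x) ((Finset.range (k x + 1)).image fun j => (π ^ (j + 1)) (b x)), Finset.sum_image]
    · intro i hi j hj hij
      simp only [Finset.coe_range, Set.mem_Iio] at hi hj
      by_contra hne
      rcases Nat.lt_or_gt_of_ne hne with h5 | h5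
      · exact hinj i j h5 (by omega) hij
      · exact hinj j i h5 (by omega) hij.symm
    · intro e
      constructor
      · intro he
        obtain ⟨j, -, rfl⟩ := Finset.mem_image.1 he
        exact ⟨(j + 1 : ℕ), by rw [zpow_natCast]⟩
      · intro he
        obtain ⟨m, rfl⟩ := he.exists_nat_pow_eq
        clear he
        induction m with
        | zero => exact Finset.mem_image.2 ⟨k x, by simp, h1.trans hx⟩
        | succ m ih =>
          obtain ⟨j, hj, hj'⟩ := Finset.mem_image.1 ih
          rw [pow_succ', Equiv.Perm.mul_apply, ← hj']
          rcases Nat.lt_or_ge j (k x) with h5 | h5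
          · refine Finset.mem_image.2 ⟨j + 1, by simpa using h5, ?_⟩
            rw [pow_succ', Equiv.Perm.mul_apply]
          · obtain rfl : j = k x := le_antisymm (by simpa [Nat.lt_succ_iff] using hj) h5
            refine Finset.mem_image.2 ⟨0, by simp, ?_⟩
            simp only [h1, hx, zero_add, pow_one]
  · have h3 : k (π x) = k x + 1 := by
      refine le_antisymm (hmin _ _ (by rw [hbπ, h1])) ?_
      have h4 := hspec (π x)
      rw [hbπ] at h4
      cases hm : k (π x) with
      | zero =>
        rw [hm] at h4
        exact absurd h4.symm hx
      | succ m =>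
        rw [hm, pow_succ', Equiv.Perm.mul_apply] at h4
        exact Nat.succ_le_succ (hmin _ _ (π.injective h4))
    rw [h3]


/-! ### Plane duality of trees, edge groups and Jacobians. -/

/-- `H` is the plane dual of the connected planar ribbon graph `G`, on the same set of darts. The
relation is symmetric. -/
structure IsDual {V W D : Type*} (G : RibbonGraph V D) (H : RibbonGraph W D) : Prop where
  rev : ∀ d, H.rev d = G.rev d
  next : ∀ d, H.next d = G.rev (G.next d)
  connected : G.Connected
  connected' : H.Connected
  euler : 2 * Nat.card V + 2 * Nat.card W = Nat.card D + 4

namespace IsDual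

variable {V W D : Type*} {G : RibbonGraph V D} {H : RibbonGraph W D}

theorem symm (h : IsDual G H) : IsDual H G where
  rev d := (h.rev d).symm
  next d := by rw [h.rev, h.next, G.rev_rev]
  connected := h.connected'
  connected' := h.connected
  euler := by rw [add_comm, h.euler]

theorem head_next (h : IsDual G H) (d : D) : G.head (H.next d) = G.tail d := by
  rw [h.next, head_rev, G.tail_next]

section Faces

variable [Fintype D]

open Classical in
theorem sum_next {M : Type*} [AddCommMonoid M] (f : D → M) (w : W) :
    ∑ d with H.tail d = w, f (H.next d) = ∑ d with H.tail d = w, f d :=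
  Finset.sum_equiv H.next (by simp [H.tail_next]) fun _ _ => rfl

open Classical in
-- Successive darts of a face walk are joined head to tail (`head_next`), so the heads are a
-- rearrangement of the tails.
theorem sum_bd_face (h : IsDual G H) (w : W) : ∑ d with H.tail d = w, G.bd d = 0 := by
  apply Subtype.ext
  simp only [AddSubgroup.val_finsetSum, bd, Finset.sum_sub_distrib, ZeroMemClass.coe_zero]
  rw [← sum_next, sub_eq_zero]
  simp only [h.head_next]

/-- If the faces `U` joined to `f` without crossing the tree were not all faces, the edges between
`U` and the rest would lie in the tree. They are the total boundary of the faces in `U`, hence a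
cycle, and a tree supports none; this contradicts the connectedness of `H`. -/
theorem exists_walk_compl [Finite W] (h : IsDual G H) {q : V} {ρ : G.RotorConfig q}
    (hρ : IsTreeRotor ρ) (f w : W) : ∃ l, H.IsWalk w l f ∧ ∀ d ∈ l, d ∈ (rotorEdges ρ)ᶜ := by
  classical
  have := Fintype.ofFinite W
  let U : Set W := {w | ∃ l, H.IsWalk w l f ∧ ∀ d ∈ l, d ∈ (rotorEdges ρ)ᶜ}
  by_contra hw
  have h0 : (Finset.univ.filter fun d => H.tail d ∈ U ∧ H.head d ∉ U) = ∅ := by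
    refine hρ.eq_empty_of_sum_bd ?_ ?_ ?_
    · intro d hd
      simp only [Finset.mem_filter, Finset.mem_univ, true_and] at hd
      obtain ⟨⟨l, hl, hl'⟩, hd⟩ := hd
      by_contra hd'
      refine hd ⟨H.rev d :: l, ⟨tail_rev d, by rwa [head_rev]⟩, fun e he => ?_⟩
      rcases List.mem_cons.1 he with rfl | he
      · rw [h.rev]
        exact fun hh => hd' (rev_mem_rotorEdges.1 hh)
      · exact hl' e he
    · intro d hd hd'
      simp only [Finset.mem_filter, Finset.mem_univ, true_and] at hd hd'
      rw [← h.rev, tail_rev] at hd'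
      exact hd.2 hd'.1
    · rw [← sum_fiber (fun d => by rw [h.rev, bd_rev]) U, sum_tail_mem]
      exact Finset.sum_eq_zero fun v _ => h.sum_bd_face v
  obtain ⟨l, hl⟩ := h.connected'.2 f w
  refine hw (hl.mem_of_closed (U := U) (fun d _ hd => ?_) ⟨[], rfl, by simp⟩)
  by_contra hd'
  exact Finset.notMem_empty d (h0 ▸ by simp [hd, hd'])

/-- The complement of a spanning tree is a spanning tree of the dual. -/
theorem exists_dual_rotor [Finite V] [Finite W] (h : IsDual G H) {q : V} {ρ : G.RotorConfig q}
    (hρ : IsTreeRotor ρ) (f : W) :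
    ∃ σ : H.RotorConfig f, IsTreeRotor σ ∧ rotorEdges σ = (rotorEdges ρ)ᶜ := by
  obtain ⟨σ, hσ, hσ'⟩ := exists_treeRotor (h.exists_walk_compl hρ f)
  refine ⟨σ, hσ, Set.eq_of_subset_of_ncard_le ?_ ?_⟩
  · rintro d ⟨w, rfl | rfl⟩
    · exact hσ' w
    · rw [h.rev]
      exact fun hh => hσ' w (rev_mem_rotorEdges.1 hh)
  -- The two trees have `2|V| - 2` and `2|W| - 2` darts; by Euler's formula these add up to `|D|`,
  -- so the inclusion is an equality.
  · have h1 := hρ.card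
    have h2 := hσ.card
    have h3 := Set.ncard_add_ncard_compl (rotorEdges ρ)
    have h4 := h.euler
    omega

theorem exists_dual_tree [Finite V] [Finite W] (h : IsDual G H) (T : G.SpanningTree) :
    ∃ S : H.SpanningTree, S.edges = T.edgesᶜ := by
  obtain ⟨q⟩ := h.connected.1
  obtain ⟨f⟩ := h.connected'.1
  obtain ⟨σ, h1, h2⟩ := h.exists_dual_rotor (T.isTreeRotor q) f
  exact ⟨treeOfRotor σ h1, h2.trans (by rw [T.edges_eq q])⟩

/-- The bijection between the spanning trees of `G` and those of its dual. -/
noncomputable def treeEquiv [Finite V] [Finite W] (h : IsDual G H) :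
    G.SpanningTree ≃ H.SpanningTree where
  toFun T := (h.exists_dual_tree T).choose
  invFun S := (h.symm.exists_dual_tree S).choose
  left_inv T := by
    ext1
    rw [(h.symm.exists_dual_tree _).choose_spec, (h.exists_dual_tree T).choose_spec, compl_compl]
  right_inv S := by
    ext1
    rw [(h.exists_dual_tree _).choose_spec, (h.symm.exists_dual_tree S).choose_spec, compl_compl]

theorem treeEquiv_edges [Finite V] [Finite W] (h : IsDual G H) (T : G.SpanningTree) :
    (h.treeEquiv T).edges = T.edgesᶜ := (h.exists_dual_tree T).choose_spec

open Classical in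
/-- The chains without boundary are generated by the boundaries of the faces. -/
theorem ker_boundaryZE_le [Finite V] [Finite W] (h : IsDual G H) {N : AddSubgroup G.ZE}
    (hN : ∀ w, ∑ d with H.tail d = w, G.edge d ∈ N) : G.boundaryZE.ker ≤ N := by
  have := Fintype.ofFinite W
  obtain ⟨q⟩ := h.connected.1
  obtain ⟨f⟩ := h.connected'.1
  obtain ⟨ρ, hρ⟩ := h.connected.exists_treeRotor q
  obtain ⟨σ, ⟨k, hk⟩, hσ'⟩ := h.exists_dual_rotor hρ f
  suffices H' : G.boundaryZE.ker ≤ N ⊓ G.boundaryZE.ker from fun x hx => (H' hx).1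
  have hN' : ∀ w, ∑ d with H.tail d = w, G.edge d ∈ N ⊓ G.boundaryZE.ker := fun w =>
    ⟨hN w, AddMonoidHom.mem_ker.2 (by simp only [map_sum, boundaryZE_edge, h.sum_bd_face])⟩
  refine hρ.ker_boundaryZE_le inf_le_right ?_
  set M := (N ⊓ G.boundaryZE.ker) ⊔ AddSubgroup.closure (Set.range fun v => G.edge (ρ v).1)
  have hρM : ∀ d ∈ rotorEdges ρ, G.edge d ∈ M := fun d hd =>
    AddSubgroup.mem_sup_right (edge_mem_closure_rotor hd)
  -- The dual tree is pruned from its leaves. Modulo the face at `w`, the rotor of `w` is a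
  -- combination of edges of `ρ` and of dual rotors pointing into `w`, whose vertices are higher;
  -- hence the induction on the total height minus `k w`.
  have hσM : ∀ w, G.edge (σ w).1 ∈ M := by
    have hB : ∀ w, k w ≤ ∑ u, k u := fun w =>
      Finset.single_le_sum (fun _ _ => Nat.zero_le _) (Finset.mem_univ w)
    have key : ∀ (n : ℕ) (w), ∑ u, k u - k w.1 = n → G.edge (σ w).1 ∈ M := by
      intro n
      induction n using Nat.strong_induction_on with
      | _ n ih =>
        rintro w rfl
        have h1 : (σ w).1 ∈ Finset.univ.filter fun d => H.tail d = w := by simp [(σ w).2]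
        have h2 : ∑ d with H.tail d = w, G.edge d ∈ M := AddSubgroup.mem_sup_left (hN' w)
        rw [← Finset.add_sum_erase _ _ h1] at h2
        refine (add_mem_cancel_right (sum_mem fun d hd => ?_)).1 h2
        simp only [Finset.mem_erase, Finset.mem_filter, Finset.mem_univ, true_and] at hd
        by_cases hd' : d ∈ rotorEdges ρ
        · exact hρM d hd'
        rw [← Set.mem_compl_iff, ← hσ'] at hd'
        obtain ⟨u, rfl | rfl⟩ := hd'
        · obtain rfl : u = w := Subtype.ext ((σ u).2.symm.trans hd.2)
          exact absurd rfl hd.1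
        · rw [h.rev, edge_rev]
          refine neg_mem (ih _ ?_ u rfl)
          have h3 := hk u
          rw [← tail_rev, hd.2] at h3
          have h4 := hB u
          omega
    exact fun w => key _ w rfl
  intro d
  by_cases hd : d ∈ rotorEdges ρ
  · exact hρM d hd
  · rw [← Set.mem_compl_iff, ← hσ'] at hd
    obtain ⟨u, rfl | rfl⟩ := hd
    · exact hσM u
    · rw [h.rev, edge_rev]
      exact neg_mem (hσM u)

theorem edgeClass_rev (d : D) : G.edgeClass (G.rev d) = - G.edgeClass d := by
  rw [edgeClass, edge_rev]
  rfl

open Classical in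
theorem sum_edgeClass_tail [Finite W] (h : IsDual G H) (v : V) :
    ∑ d with G.tail d = v, H.edgeClass d = 0 := by
  apply sum_edgeClass_eq_zero
  apply AddSubgroup.mem_sup_left
  rw [← h.connected'.ker_boundaryZE, AddMonoidHom.mem_ker]
  simp only [map_sum, boundaryZE_edge, h.symm.sum_bd_face]

/-- Edge duality, as a homomorphism on the edge group. -/
noncomputable def edgeHom [Finite V] [Finite W] (h : IsDual G H) : G.EdgeGroup →+ H.EdgeGroup :=
  liftEdgeGroup (liftZE H.edgeClass fun d => by rw [← h.rev, edgeClass_rev]) (by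
    classical
    have := Fintype.ofFinite V
    refine sup_le (cycleSpace_le.trans (h.ker_boundaryZE_le fun w => ?_)) ?_
    · rw [AddMonoidHom.mem_ker]
      simp only [map_sum, liftZE_edge, sum_edgeClass]
    · rw [cutSpace, AddSubgroup.closure_le]
      rintro _ ⟨U, rfl⟩
      rw [SetLike.mem_coe, AddMonoidHom.mem_ker, cut_eq_sum_tail]
      simp only [map_sum, liftZE_edge]
      rw [sum_tail_mem]
      exact Finset.sum_eq_zero fun v _ => h.sum_edgeClass_tail v)

theorem edgeHom_edgeClass [Finite V] [Finite W] (h : IsDual G H) (d : D) :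
    h.edgeHom (G.edgeClass d) = H.edgeClass d := by
  rw [edgeHom, liftEdgeGroup_edgeClass, liftZE_edge]

theorem symm_comp_edgeHom [Finite V] [Finite W] (h : IsDual G H) :
    h.symm.edgeHom.comp h.edgeHom = AddMonoidHom.id G.EdgeGroup := by
  have h1 : ∀ d, h.symm.edgeHom.comp h.edgeHom (G.edgeClass d) =
      AddMonoidHom.id G.EdgeGroup (G.edgeClass d) := fun d =>
    (congrArg _ (h.edgeHom_edgeClass d)).trans (h.symm.edgeHom_edgeClass d)
  exact edgeGroup_hom_ext (G := G) (A := G.EdgeGroup) (g := h.symm.edgeHom.comp h.edgeHom)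
    (g' := AddMonoidHom.id G.EdgeGroup) h1

/-- Edge duality, as an isomorphism of edge groups. -/
noncomputable def edgeEquiv [Finite V] [Finite W] (h : IsDual G H) : G.EdgeGroup ≃+ H.EdgeGroup :=
  AddMonoidHom.toAddEquiv h.edgeHom h.symm.edgeHom h.symm_comp_edgeHom h.symm.symm_comp_edgeHom

theorem edgeEquiv_edgeClass [Finite V] [Finite W] (h : IsDual G H) (d : D) :
    h.edgeEquiv (G.edgeClass d) = H.edgeClass d := h.edgeHom_edgeClass d

/-- The isomorphism of sandpile groups induced by edge duality. -/
noncomputable def jacEquiv [Finite V] [Finite W] (h : IsDual G H) : G.Jac ≃+ H.Jac :=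
  (AddEquiv.ofBijective G.boundary (boundary_bijective h.connected)).symm.trans
    (h.edgeEquiv.trans (AddEquiv.ofBijective H.boundary (boundary_bijective h.connected')))

theorem jacEquiv_boundary [Finite V] [Finite W] (h : IsDual G H) (x : G.EdgeGroup) :
    h.jacEquiv (G.boundary x) = H.boundary (h.edgeEquiv x) := by
  have h1 : (AddEquiv.ofBijective G.boundary (boundary_bijective h.connected)).symm
      (G.boundary x) = x :=
    (AddEquiv.ofBijective G.boundary (boundary_bijective h.connected)).symm_apply_apply x
  simp only [jacEquiv, AddEquiv.trans_apply, h1]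
  rfl

theorem jacEquiv_bd [Finite V] [Finite W] (h : IsDual G H) (d : D) :
    h.jacEquiv (G.divClass (G.bd d)) = H.divClass (H.bd d) := by
  rw [← boundary_edgeClass, jacEquiv_boundary, edgeEquiv_edgeClass, boundary_edgeClass]

/-- On a plane graph there is a rotor potential that takes the same value on both orientations of
every edge. -/
theorem exists_symmetric_potential [Finite V] [Finite W] (h : IsDual G H) :
    ∃ r : D → G.Jac, IsRotorPotential r ∧ ∀ d, r (G.rev d) = r d := by
  classical
  obtain ⟨r₀, h₀⟩ := exists_increment (π := G.next) (f := fun d => G.divClass (G.bd d))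
    fun d S hS => by
      rw [← divClass_sum, ← divClass_lend (G.tail d), lend]
      congr 2
      ext e
      rw [hS, Finset.mem_filter]
      exact ⟨fun he => ⟨Finset.mem_univ e, tail_eq_of_sameCycle he⟩,
        fun he => G.sameCycle_next _ _ he.2.symm⟩
  -- The failure of symmetry, as an antisymmetric function. Around a face it telescopes to the class
  -- of the face's boundary, which is zero.
  let g : G.ZE →+ G.Jac := liftZE (fun d => r₀ d - r₀ (G.rev d)) fun d => by
    rw [G.rev_rev, neg_sub]
  have hg : G.boundaryZE.ker ≤ g.ker := by
    refine h.ker_boundaryZE_le fun w => ?_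
    rw [AddMonoidHom.mem_ker]
    simp only [g, map_sum, liftZE_edge, Finset.sum_sub_distrib]
    rw [← sum_next (fun d => r₀ (G.rev d))]
    have h1 : ∀ d, r₀ (G.rev (H.next d)) = r₀ d - G.divClass (G.bd (H.next d)) := fun d => by
      rw [h.next, G.rev_rev, h₀, bd_rev]
      exact (sub_neg_eq_add _ _).symm
    simp only [h1, Finset.sum_sub_distrib]
    rw [sum_next (fun d => G.divClass (G.bd d)), ← divClass_sum, h.sum_bd_face, sub_sub_cancel]
    rfl
  obtain ⟨a, ha⟩ := h.connected.exists_potential g hg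
  -- A constant at each vertex does not affect the increments of `r₀`, and these constants cancel
  -- the coboundary.
  refine ⟨fun d => r₀ d + a (G.tail d), fun d => ?_, fun d => ?_⟩
  · simp only [G.tail_next, h₀]
    abel
  · have h1 := ha d
    rw [liftZE_edge, sub_eq_sub_iff_add_eq_add] at h1
    simp only [tail_rev]
    rw [add_comm, ← h1]

end Faces

end IsDual

/-! ### Basepoint-free potential of a tree and compatibility of the actions. -/

section Orientation

variable {V D : Type*} {G : RibbonGraph V D}

open Classical in
-- Each tree edge carries exactly one rotor, so for symmetric `f` the choice of `q` drops out.
theorem IsTreeRotor.sum_rotor {q : V} [Fintype {v : V // v ≠ q}] {ρ : G.RotorConfig q}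
    (hρ : IsTreeRotor ρ) {J : Type*} [AddCommGroup J] {f : D → J} (hf : ∀ d, f (G.rev d) = f d)
    {O : Finset D} (hO : ∀ d, G.rev d ∈ O ↔ d ∉ O) :
    ∑ v, f (ρ v).1 = ∑ d ∈ O with d ∈ rotorEdges ρ, f d := by
  refine Finset.sum_bij (fun v _ => if (ρ v).1 ∈ O then (ρ v).1 else G.rev (ρ v).1) ?_ ?_ ?_ ?_
  · intro v _
    rw [Finset.mem_filter]
    split_ifs with h
    · exact ⟨h, mem_rotorEdges ρ v⟩
    · exact ⟨(hO _).2 h, rev_mem_rotorEdges.2 (mem_rotorEdges ρ v)⟩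
  · intro u _ v _ huv
    split_ifs at huv
    · exact rotorConfig_injective ρ huv
    · exact absurd huv.symm (hρ.rev_ne v u)
    · exact absurd huv (hρ.rev_ne u v)
    · exact rotorConfig_injective ρ (G.rev.injective huv)
  · intro d hd
    obtain ⟨h1, v, rfl | rfl⟩ := Finset.mem_filter.1 hd
    · exact ⟨v, Finset.mem_univ _, if_pos h1⟩
    · exact ⟨v, Finset.mem_univ _, if_neg ((hO _).1 h1)⟩
  · intro v _
    split_ifs
    · rfl
    · exact (hf _).symm

theorem exists_orientation [Fintype D] (G : RibbonGraph V D) :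
    ∃ O : Finset D, ∀ d, G.rev d ∈ O ↔ d ∉ O := by
  classical
  let e := Fintype.equivFin D
  refine ⟨Finset.univ.filter fun d => e d < e (G.rev d), fun d => ?_⟩
  have : e (G.rev d) ≠ e d := fun h => G.rev_ne d (e.injective h)
  simp only [Finset.mem_filter, Finset.mem_univ, true_and, G.rev_rev, not_lt]
  exact ⟨le_of_lt, fun h => lt_of_le_of_ne h this⟩

end Orientation

namespace IsDual

variable {V W D : Type*} {G : RibbonGraph V D} {H : RibbonGraph W D} [Finite V] [Finite W]
  [Fintype D]

theorem rotorActionWellDefined (h : IsDual G H) (q : V) : G.RotorActionWellDefined q := by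
  obtain ⟨r, hr, -⟩ := h.exists_symmetric_potential
  exact hr.rotorActionWellDefined h.connected q

theorem treeEquiv_rotorAction (h : IsDual G H) (q : V) (f : W) (c : G.Jac) (T : G.SpanningTree) :
    h.treeEquiv (G.rotorAction q c T) = H.rotorAction f (h.jacEquiv c) (h.treeEquiv T) := by
  classical
  have := Fintype.ofFinite {v : V // v ≠ q}
  have := Fintype.ofFinite {w : W // w ≠ f}
  obtain ⟨r, hr, hr'⟩ := h.exists_symmetric_potential
  obtain ⟨O, hO⟩ := exists_orientation G
  -- The sign is needed because the dual rotor advances to the reverse of `G.next d`, which negates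
  -- the boundary but leaves `r` unchanged.
  let s : D → H.Jac := fun d => - h.jacEquiv (r d)
  have hs : IsRotorPotential s := fun d => by
    simp only [s]
    rw [← jacEquiv_bd h, h.next, hr', hr, bd_rev, map_add]
    have h1 : G.divClass (- G.bd (G.next d)) = - G.divClass (G.bd (G.next d)) := rfl
    rw [h1, map_neg, neg_add]
  have hs' : ∀ d, s (H.rev d) = s d := fun d => by simp only [s, h.rev, hr']
  -- The dual tree is the complement and `s` carries a minus sign, so its sum is that of the tree
  -- minus that of all edges.
  have key : ∀ T : G.SpanningTree, ∑ w, s ((h.treeEquiv T).rotor f w).1 =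
      h.jacEquiv (∑ v, r (T.rotor q v).1) - h.jacEquiv (∑ d ∈ O, r d) := by
    intro T
    rw [((h.treeEquiv T).isTreeRotor f).sum_rotor hs' (O := O) (fun d => by rw [h.rev, hO]),
      (T.isTreeRotor q).sum_rotor hr' hO, ← SpanningTree.edges_eq, ← SpanningTree.edges_eq,
      h.treeEquiv_edges, ← Finset.sum_filter_add_sum_filter_not O (· ∈ T.edges), map_add]
    simp only [s, Set.mem_compl_iff, Finset.sum_neg_distrib, map_sum]
    abel
  refine SpanningTree.rotor_injective (q := f) (hs.rotor_unique
    (SpanningTree.isTreeRotor _ f) (SpanningTree.isTreeRotor _ f) ?_)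
  rw [hs.routesTo (routesTo_rotorAction h.connected' _ _), key, key,
    hr.routesTo (routesTo_rotorAction h.connected _ _), map_sub]
  abel

end IsDual

/-! ### The dual graph is a plane dual. -/

section DualGraph

variable {V D : Type*} {G : RibbonGraph V D}

/-- Consecutive faces around a vertex are separated by one edge, and the face after `rev d` is the
face before `d`. So reachability of faces spreads around vertices and along edges of `G`. Without
darts there is a single vertex, and hence a single face. -/
theorem dual_connected [Finite D] (hG : G.Connected) : G.dual.Connected := by
  by_cases hD : Nonempty D
  · obtain ⟨e⟩ := hD
    let C : Set D := {d | ∃ l, G.dual.IsWalk (G.faceAfter e) l (G.faceAfter d)}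
    have hnext : ∀ d ∈ C, G.next d ∈ C := by
      rintro d ⟨l, hl⟩
      refine ⟨l ++ [G.rev (G.next d)], hl.append ⟨G.dual.tail_next d, ?_⟩⟩
      exact G.dual.head_rev (G.next d)
    have htail : ∀ d ∈ C, ∀ d', G.tail d = G.tail d' → d' ∈ C := by
      intro d hd d' hd'
      obtain ⟨k, rfl⟩ := (G.sameCycle_next d d' hd').exists_nat_pow_eq
      clear hd'
      induction k with
      | zero => exact hd
      | succ k ih =>
        rw [pow_succ', Equiv.Perm.mul_apply]
        exact hnext _ ih
    have hrev : ∀ d ∈ C, G.rev d ∈ C := by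
      intro d hd
      obtain ⟨l, hl⟩ := htail d hd (G.next.symm d) 
        (by rw [← G.tail_next (G.next.symm d), Equiv.apply_symm_apply])
      have h1 := G.dual.tail_next (G.next.symm d)
      change G.faceAfter (G.rev (G.next (G.next.symm d))) = G.faceAfter (G.next.symm d) at h1
      rw [Equiv.apply_symm_apply] at h1
      exact ⟨l, h1 ▸ hl⟩
    have hV : ∀ v, ∃ d ∈ C, G.tail d = v := by
      intro v
      obtain ⟨l, hl⟩ := hG.2 (G.tail e) v
      refine hl.mem_of_closed (U := {v | ∃ d ∈ C, G.tail d = v}) ?_ ⟨e, ⟨[], rfl⟩, rfl⟩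
      rintro d _ ⟨d', hd', h⟩
      exact ⟨G.rev d, hrev d (htail d' hd' d h), rfl⟩
    have hface : ∀ w : G.Face, ∃ l, G.dual.IsWalk (G.faceAfter e) l w := by
      rintro (w | ⟨v, hv⟩)
      · obtain ⟨d, rfl⟩ := Quotient.exists_rep w
        obtain ⟨d', hd', h⟩ := hV (G.tail d)
        exact htail d' hd' d h
      · obtain ⟨d, -, hd⟩ := hV v
        exact absurd hd (hv d)
    refine ⟨⟨G.faceAfter e⟩, fun u v => ?_⟩
    obtain ⟨l, hl⟩ := hface u
    obtain ⟨l', hl'⟩ := hface v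
    exact ⟨_, hl.reverse.append hl'⟩
  · obtain ⟨v₀⟩ := hG.1
    refine ⟨⟨Sum.inr ⟨v₀, fun d => absurd ⟨d⟩ hD⟩⟩, ?_⟩
    rintro (w | ⟨u, hu⟩)
    · obtain ⟨d, -⟩ := Quotient.exists_rep w
      exact absurd ⟨d⟩ hD
    rintro (w | ⟨v, hv⟩)
    · obtain ⟨d, -⟩ := Quotient.exists_rep w
      exact absurd ⟨d⟩ hD
    obtain ⟨_ | ⟨d, l⟩, hl⟩ := hG.2 u v
    · obtain rfl : u = v := hl
      exact ⟨[], rfl⟩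
    · exact absurd ⟨d⟩ hD

theorem isDual_dual [Finite D] (h : G.IsPlanar) : IsDual G G.dual where
  rev _ := rfl
  next _ := rfl
  connected := h.1
  connected' := dual_connected h.1
  euler := h.2

end DualGraph

end RibbonGraph

theorem mainTheorem1 {V D : Type*} [Finite V] [Fintype D] (G : RibbonGraph V D)
    (hplanar : G.IsPlanar) (hloop : G.Loopless) (hloop' : G.dual.Loopless) :
    -- rotor-routing is well defined on `G` and on `G*`, for all basepoints
    (∀ q, G.RotorActionWellDefined q) ∧ (∀ f, G.dual.RotorActionWellDefined f) ∧
    -- the isomorphism `ψ` given by edge duality, the induced isomorphism `φ`, and the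
    -- dual-tree bijection `δ`
    ∃ (ψ : G.EdgeGroup ≃+ G.dual.EdgeGroup) (φ : G.Jac ≃+ G.dual.Jac)
      (δ : G.SpanningTree ≃ G.dual.SpanningTree),
      (∀ d, ψ (G.edgeClass d) = G.dual.edgeClass d) ∧
      (∀ x, φ (G.boundary x) = G.dual.boundary (ψ x)) ∧
      (∀ T, (δ T).edges = (T.edges)ᶜ) ∧
      -- compatibility of the two actions, for all basepoints
      ∀ (q : V) (f : G.Face) (c : G.Jac) (T : G.SpanningTree),
        δ (G.rotorAction q c T) = G.dual.rotorAction f (φ c) (δ T) := by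
  have h := RibbonGraph.isDual_dual hplanar
  exact ⟨h.rotorActionWellDefined, h.symm.rotorActionWellDefined, h.edgeEquiv, h.jacEquiv,
    h.treeEquiv, h.edgeEquiv_edgeClass, h.jacEquiv_boundary, h.treeEquiv_edges,
    h.treeEquiv_rotorAction⟩
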